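/- Fix integers $p,q\ge 1$, a $q\times p$ matrix $Z=(\zeta_{ji})$ of non-negative integers without zero rows and zero columns, and non-negative integers $\Lambda=(\lambda_1,\dots,\lambda_q)$. Let $\mathbb N_1,\dots,\mathbb N_p$ be copies of $\mathbb N=\{1,2,\dots\}$, let $\mathbb I(\zeta)$ be a set with $\zeta$ elements and $L_j$ a set with $\lambda_j$ elements, and put $\Omega_j=L_j\sqcup\coprod_{i\le p}\bigl(\mathbb N_i\times\mathbb I(\zeta_{ji})\bigr)$. For a set $\Omega$ let $\mathbb S_\infty(\Omega)$ be the group of permutations of $\Omega$ that fix all but finitely many points. Let $$G=\prod_{j=1}^q\mathbb S_\infty(\Omega_j),\qquad K^\circ=\prod_{i=1}^p\Bigl(\mathbb S_\infty(\mathbb N_i)\ltimes\bigl(\textstyle\prod_j S_{\zeta_{ji}}\bigr)^\infty\Bigr)\subset G,\qquad K^\circledast=\prod_{i=1}^p\mathbb S_\infty(\mathbb N_i)\subset K^\circ,$$ where $U^\infty$ is the group of finitely supported sequences in $U$, $\mathbb S_\infty(\mathbb N_i)$ acts on the first factor of all the sets $\mathbb N_i\times\mathbb I(\zeta_{ji})$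 simultaneously, and the $n$-th factor of $(\prod_j S_{\zeta_{ji}})^\infty$ permutes each of the sets $\{n\}\times\mathbb I(\zeta_{ji})$. Let $K$ be $K^\circ$ or $K^\circledast$. For a multi-index $\alpha=(\alpha_1,\dots,\alpha_p)$ of non-negative integers let $K^\alpha\subset K$ be the subgroup of elements whose components in $\mathbb S_\infty(\mathbb N_i)$ fix $1,\dots,\alpha_i$ and whose components in $(\prod_j S_{\zeta_{ji}})^\infty$ (for $K=K^\circ$) are trivial at the first $\alpha_i$ places, for all $i$. Let $\Theta_N^{[\alpha]}\in K^\alpha\cap K^\circledast$ be the element whose $i$-th component is the permutation of $\mathbb N_i$ that exchanges $\alpha_i+t$ and $\alpha_i+N+t$ for $1\le t\le N$ and fixes all other points. The category $\mathbb T(G,K)$ has the multi-indices $\alpha$ as objects and the double cosets $K^\beta\backslash G/K^\alpha$ as morphisms $\alpha\to\beta$; the composition of $\mathfrak h=K^\beta hK^\alpha$ and $\mathfrak g=K^\gamma gK^\beta$ is $$\mathfrak g\circ\mathfrak h=\lim_{N\to\infty}K^\gamma\, g\,\Theta_N^{[\beta]}\,h\,K^\alpha$$ (the sequence is eventually constant,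 its limit does not depend on the representatives $g$, $h$, and this product is associative, with the double cosets of $1$ as units). The map $g\mapsto g^{-1}$ induces an involution $\mathfrak g\mapsto\mathfrak g^\square$ from morphisms $\alpha\to\beta$ to morphisms $\beta\to\alpha$. A unitary representation $\rho$ of $G$ in a complex Hilbert space $H$ is called $K$-admissible if $\bigcup_\alpha H^\alpha$ is dense in $H$, where $H^\alpha$ is the subspace of $K^\alpha$-fixed vectors. A contractive $*$-representation of $\mathbb T(G,K)$ consists of complex Hilbert spaces $V_\alpha$ and bounded operators $T(\mathfrak g):V_\alpha\to V_\beta$ for all $\mathfrak g:\alpha\to\beta$, such that $T(1_\alpha)=1$, $T(\mathfrak g\circ\mathfrak h)=T(\mathfrak g)T(\mathfrak h)$, $T(\mathfrak g^\square)=T(\mathfrak g)^*$ and $\|T(\mathfrak g)\|\le 1$. Theorem. Let $\rho$ be a $K$-admissible unitary representation of $G$ in $H$ and let $P^\beta$ be the orthogonal projection of $H$ onto $H^\beta$. For $g\in\mathfrak g\in K^\beta\backslash G/K^\alpha$ the operator $\overline\rho_{\alpha,\beta}(\mathfrak g):=P^\beta\rho(g)|_{H^\alpha}:H^\alpha\to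 H^\beta$ depends only on $\mathfrak g$, and the spaces $H^\alpha$ with these operators form a contractive $*$-representation of $\mathbb T(G,K)$. The map $\rho\mapsto\overline\rho$ induces a bijection between the set of unitary equivalence classes of $K$-admissible unitary representations of $G$ and the set of unitary equivalence classes of contractive $*$-representations of $\mathbb T(G,K)$. -/

import Mathlib

universe u

namespace SymTrain

open Equiv CategoryTheory

/-- The group of finite permutations of a set `X`: all but finitely many points are fixed. -/
def finitary (X : Type*) : Subgroup (Perm X) where
  carrier := {σ | {x | σ x ≠ x}.Finite}
  one_mem' := by simp
  mul_mem' := by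
    intro a b ha hb
    refine (ha.union hb).subset fun x hx => ?_
    by_contra h
    simp only [Set.mem_union, Set.mem_ofPred_eq, not_or, not_not] at h
    exact hx (by simp [h.1, h.2])
  inv_mem' := by
    intro a ha
    refine ha.subset fun x hx h => hx ?_
    exact (Perm.inv_eq_iff_eq).2 h.symm

lemma mem_finitary_iff {X : Type*} {σ : Perm X} : σ ∈ finitary X ↔ {x | σ x ≠ x}.Finite :=
  Iff.rfl

lemma finite_nat_iff {P : ℕ → Prop} : {n | ¬ P n}.Finite ↔ ∃ M, ∀ n, M ≤ n → P n := by
  constructor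
  · intro h
    obtain ⟨M, hM⟩ := h.bddAbove
    refine ⟨M + 1, fun n hn => ?_⟩
    by_contra hp
    have : n ≤ M := hM hp
    omega
  · rintro ⟨M, hM⟩
    refine (Set.finite_lt_nat M).subset fun n hn => ?_
    by_contra h
    exact hn (hM n (not_lt.1 h))

variable {p q : ℕ}

/-- The set `Ω_j = L_j ⊔ ∐_i (ℕ_i × 𝕀(ζ_{ji}))`, with `L_j = Fin (Λ j)` and `𝕀(ζ) = Fin ζ`. -/
abbrev Omega (Z : Matrix (Fin q) (Fin p) ℕ) (Λ : Fin q → ℕ) (j : Fin q) : Type :=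
  Fin (Λ j) ⊕ (Σ i : Fin p, ℕ × Fin (Z j i))

/-- The group `G[Z, Λ] = ∏_j 𝕊_∞(Ω_j)`. -/
abbrev GGroup (Z : Matrix (Fin q) (Fin p) ℕ) (Λ : Fin q → ℕ) : Type :=
  ∀ j : Fin q, finitary (Omega Z Λ j)

/-- The permutation of `Ω_j` given by permutations `σ_i` of `ℕ_i` and, for every `i` and every
`n ∈ ℕ_i`, permutations of the finite sets `{n} × 𝕀(ζ_{ji})`: it fixes `L_j` pointwise and sends
`(n, m) ∈ ℕ_i × 𝕀(ζ_{ji})` to `(σ_i n, u_{i,n,j} m)`. -/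
def wreathPerm (Z : Matrix (Fin q) (Fin p) ℕ) (Λ : Fin q → ℕ) (σ : Fin p → Perm ℕ)
    (u : ∀ i : Fin p, ℕ → ∀ j : Fin q, Perm (Fin (Z j i))) (j : Fin q) : Perm (Omega Z Λ j) :=
  Equiv.sumCongr (Equiv.refl _)
    (Equiv.sigmaCongrRight fun i => Equiv.prodShear (σ i) fun n => u i n j)

/-- The two kinds of subgroups `K ⊂ G`: `K^∘[Z]` and `K^⊛[Z]`. -/
inductive PairKind : Type
  | circ
  | circledast

/-- The group acting inside a column: all of `∏_j S_{ζ_{ji}}` for `K^∘`, and the trivial group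
for `K^⊛`. -/
def PairKind.inner (κ : PairKind) (Z : Matrix (Fin q) (Fin p) ℕ) (i : Fin p) :
    Subgroup (∀ j : Fin q, Perm (Fin (Z j i))) :=
  match κ with
  | .circ => ⊤
  | .circledast => ⊥

/-- `(σ, u)` is an element of the product over `i` of the semidirect products
`𝕊_∞^{α_i}(ℕ_i) ⋉ (U_i)^{∞ - α_i}`, where `U_i` is `κ.inner Z i`. The first `α_i` elements of
`ℕ_i` are those with `n < α_i`. -/
structure IsWreath (κ : PairKind) {Z : Matrix (Fin q) (Fin p) ℕ} (α : Fin p → ℕ)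
    (σ : Fin p → Perm ℕ) (u : ∀ i : Fin p, ℕ → ∀ j : Fin q, Perm (Fin (Z j i))) : Prop where
  perm_finitary : ∀ i, σ i ∈ finitary ℕ
  finite_support : ∀ i, {n | u i n ≠ 1}.Finite
  mem_inner : ∀ i n, u i n ∈ κ.inner Z i
  perm_fix : ∀ i n, n < α i → σ i n = n
  inner_fix : ∀ i n, n < α i → u i n = 1

section Wreath

variable {κ : PairKind} {Z : Matrix (Fin q) (Fin p) ℕ} {Λ : Fin q → ℕ}

@[simp] lemma wreathPerm_inl (σ : Fin p → Perm ℕ)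
    (u : ∀ i : Fin p, ℕ → ∀ j : Fin q, Perm (Fin (Z j i))) (j : Fin q) (l : Fin (Λ j)) :
    wreathPerm Z Λ σ u j (Sum.inl l) = Sum.inl l := rfl

@[simp] lemma wreathPerm_inr (σ : Fin p → Perm ℕ)
    (u : ∀ i : Fin p, ℕ → ∀ j : Fin q, Perm (Fin (Z j i))) (j : Fin q) (i : Fin p) (n : ℕ)
    (m : Fin (Z j i)) :
    wreathPerm Z Λ σ u j (Sum.inr ⟨i, n, m⟩) = Sum.inr ⟨i, σ i n, u i n j m⟩ := rfl

lemma wreathPerm_one (j : Fin q) : wreathPerm Z Λ (1 : Fin p → Perm ℕ) 1 j = 1 := by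
  ext x
  rcases x with l | ⟨i, n, m⟩ <;> simp

lemma wreathPerm_mul (σ τ : Fin p → Perm ℕ)
    (u v : ∀ i : Fin p, ℕ → ∀ j : Fin q, Perm (Fin (Z j i))) (j : Fin q) :
    wreathPerm Z Λ σ u j * wreathPerm Z Λ τ v j =
      wreathPerm Z Λ (σ * τ) (fun i n => u i (τ i n) * v i n) j := by
  ext x
  rcases x with l | ⟨i, n, m⟩ <;> simp

lemma IsWreath.one (α : Fin p → ℕ) : IsWreath κ (Z := Z) α 1 1 where
  perm_finitary _ := one_mem _
  finite_support i := by simp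
  mem_inner i n := one_mem _
  perm_fix i n _ := rfl
  inner_fix i n _ := rfl

lemma IsWreath.mul {α : Fin p → ℕ} {σ τ : Fin p → Perm ℕ}
    {u v : ∀ i : Fin p, ℕ → ∀ j : Fin q, Perm (Fin (Z j i))}
    (h : IsWreath κ α σ u) (h' : IsWreath κ α τ v) :
    IsWreath κ α (σ * τ) (fun i n => u i (τ i n) * v i n) where
  perm_finitary i := mul_mem (h.perm_finitary i) (h'.perm_finitary i)
  finite_support i := by
    refine (((h.finite_support i).preimage (τ i).injective.injOn).union
      (h'.finite_support i)).subset fun n hn => ?_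
    by_contra hc
    simp only [Set.mem_union, Set.mem_preimage, Set.mem_ofPred_eq, not_or, not_not] at hc
    exact hn (by simp [hc.1, hc.2])
  mem_inner i n := mul_mem (h.mem_inner _ _) (h'.mem_inner _ _)
  perm_fix i n hn := by simp [h'.perm_fix i n hn, h.perm_fix i n hn]
  inner_fix i n hn := by simp [h'.perm_fix i n hn, h.inner_fix i n hn, h'.inner_fix i n hn]

lemma IsWreath.inv {α : Fin p → ℕ} {σ : Fin p → Perm ℕ}
    {u : ∀ i : Fin p, ℕ → ∀ j : Fin q, Perm (Fin (Z j i))} (h : IsWreath κ α σ u) :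
    IsWreath κ α σ⁻¹ (fun i n => (u i ((σ i)⁻¹ n))⁻¹) where
  perm_finitary i := inv_mem (h.perm_finitary i)
  finite_support i := by
    refine ((h.finite_support i).preimage (σ i)⁻¹.injective.injOn).subset fun n hn => ?_
    simpa using hn
  mem_inner i n := inv_mem (h.mem_inner _ _)
  perm_fix i n hn := (Perm.inv_eq_iff_eq).2 (h.perm_fix i n hn).symm
  inner_fix i n hn := by
    have : (σ i)⁻¹ n = n := (Perm.inv_eq_iff_eq).2 (h.perm_fix i n hn).symm
    simp only [this, h.inner_fix i n hn, inv_one]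

lemma wreathPerm_inv (σ : Fin p → Perm ℕ)
    (u : ∀ i : Fin p, ℕ → ∀ j : Fin q, Perm (Fin (Z j i))) (j : Fin q) :
    (wreathPerm Z Λ σ u j)⁻¹ = wreathPerm Z Λ σ⁻¹ (fun i n => (u i ((σ i)⁻¹ n))⁻¹) j := by
  rw [inv_eq_iff_mul_eq_one, wreathPerm_mul]
  ext x
  rcases x with l | ⟨i, n, m⟩ <;> simp

end Wreath

/-- The subgroup `K^α ⊂ G[Z, Λ]`, where `K` is `K^∘[Z]` or `K^⊛[Z]`; for `α = 0` this is `K`. -/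
def KSub (κ : PairKind) (Z : Matrix (Fin q) (Fin p) ℕ) (Λ : Fin q → ℕ) (α : Fin p → ℕ) :
    Subgroup (GGroup Z Λ) where
  carrier := {g | ∃ σ u, IsWreath κ α σ u ∧ ∀ j, (g j : Perm (Omega Z Λ j)) = wreathPerm Z Λ σ u j}
  one_mem' := ⟨1, 1, IsWreath.one α, fun j => (wreathPerm_one j).symm⟩
  mul_mem' := by
    rintro a b ⟨σ, u, h, ha⟩ ⟨τ, v, h', hb⟩
    exact ⟨_, _, h.mul h', fun j => by rw [← wreathPerm_mul, ← ha, ← hb]; rfl⟩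
  inv_mem' := by
    rintro a ⟨σ, u, h, ha⟩
    exact ⟨_, _, h.inv, fun j => by rw [← wreathPerm_inv, ← ha]; rfl⟩

/-- The permutation `Θ_N^{[a]}` of `ℕ`: it exchanges the blocks `a, …, a + N - 1` and
`a + N, …, a + 2N - 1` and fixes all other points. -/
def theta (a N : ℕ) : Perm ℕ :=
  Function.Involutive.toPerm
    (fun n => if n < a then n else if n < a + N then n + N else if n < a + 2 * N then n - N else n)
    (by intro n; dsimp only; split_ifs <;> omega)

lemma theta_apply (a N n : ℕ) : theta a N n =
    if n < a then n else if n < a + N then n + N else if n < a + 2 * N then n - N else n := rfl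

@[simp] lemma theta_theta (a N n : ℕ) : theta a N (theta a N n) = n := by
  simp only [theta_apply]; split_ifs <;> omega

lemma theta_mem (a N : ℕ) : theta a N ∈ finitary ℕ :=
  finite_nat_iff.2 ⟨a + 2 * N, fun n hn => by rw [theta_apply]; split_ifs <;> omega⟩

section Diag

variable {κ : PairKind} {Z : Matrix (Fin q) (Fin p) ℕ} {Λ : Fin q → ℕ}

lemma finite_cols (Z : Matrix (Fin q) (Fin p) ℕ) (Λ : Fin q → ℕ) (M : ℕ) (j : Fin q) :
    {x : Omega Z Λ j | ∀ i n m, x = Sum.inr ⟨i, n, m⟩ → n < M}.Finite := by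
  refine (Set.finite_range (Sum.map id (Sigma.map id fun _ => Prod.map Fin.val id) :
    Fin (Λ j) ⊕ (Σ i : Fin p, Fin M × Fin (Z j i)) → Omega Z Λ j)).subset ?_
  rintro (l | ⟨i, n, m⟩) hx
  · exact ⟨Sum.inl l, rfl⟩
  · exact ⟨Sum.inr ⟨i, ⟨n, hx i n m rfl⟩, m⟩, rfl⟩

/-- The diagonal embedding of `∏_i 𝕊_∞(ℕ_i)` into `G`. -/
def diag (Z : Matrix (Fin q) (Fin p) ℕ) (Λ : Fin q → ℕ) :
    (Fin p → finitary ℕ) →* GGroup Z Λ where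
  toFun σ := fun j => ⟨wreathPerm Z Λ (fun i => σ i) 1 j, by
    have : ∀ i, ∃ M, ∀ n, M ≤ n → (σ i : Perm ℕ) n = n := fun i => finite_nat_iff.1 (σ i).2
    choose M hM using this
    refine (finite_cols Z Λ (Finset.univ.sup M) j).subset ?_
    rintro x hx i n m rfl
    by_contra hn
    have h1 : M i ≤ n := (Finset.le_sup (Finset.mem_univ i)).trans (not_lt.1 hn)
    exact hx (by simp [hM i n h1])⟩
  map_one' := by
    funext j
    exact Subtype.ext (wreathPerm_one j)
  map_mul' σ τ := by
    funext j
    refine Subtype.ext ?_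
    change _ = wreathPerm Z Λ _ 1 j * wreathPerm Z Λ _ 1 j
    rw [wreathPerm_mul]
    congr 1

end Diag

/-- The element `Θ_N^{[α]} = (Θ_N^{[α_1]}, …, Θ_N^{[α_p]})` of `K ⊂ G`. -/
def Theta (Z : Matrix (Fin q) (Fin p) ℕ) (Λ : Fin q → ℕ) (α : Fin p → ℕ) (N : ℕ) : GGroup Z Λ :=
  diag Z Λ fun i => ⟨theta (α i) N, theta_mem (α i) N⟩

section Product

variable {κ : PairKind} {Z : Matrix (Fin q) (Fin p) ℕ} {Λ : Fin q → ℕ}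

lemma diag_mem {σ : Fin p → finitary ℕ} {α : Fin p → ℕ}
    (h : ∀ i n, n < α i → (σ i : Perm ℕ) n = n) : diag Z Λ σ ∈ KSub κ Z Λ α :=
  ⟨fun i => σ i, 1, ⟨fun i => (σ i).2, by simp, fun _ _ => one_mem _, h, fun _ _ _ => rfl⟩,
    fun _ => rfl⟩

lemma KSub_anti {α α' : Fin p → ℕ} (h : ∀ i, α i ≤ α' i) : KSub κ Z Λ α' ≤ KSub κ Z Λ α := by
  rintro g ⟨σ, u, hw, hg⟩
  exact ⟨σ, u, ⟨hw.1, hw.2, hw.3, fun i n hn => hw.4 i n (hn.trans_le (h i)),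
    fun i n hn => hw.5 i n (hn.trans_le (h i))⟩, hg⟩

/-- Every element of `G` commutes with `K^α` for large `α`. -/
lemma exists_commute (κ : PairKind) (g : GGroup Z Λ) :
    ∃ M, ∀ k ∈ KSub κ Z Λ fun _ => M, k * g = g * k := by
  have : ∀ j, ∃ M, ∀ i n m, M ≤ n →
      (g j : Perm (Omega Z Λ j)) (Sum.inr ⟨i, n, m⟩) = Sum.inr ⟨i, n, m⟩ := by
    intro j
    obtain ⟨M, hM⟩ := ((g j).2.image
      (Sum.elim (fun _ => 0) (fun x => x.2.1) : Omega Z Λ j → ℕ)).bddAbove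
    refine ⟨M + 1, fun i n m hn => ?_⟩
    by_contra hc
    have : n ≤ M := hM ⟨Sum.inr ⟨i, n, m⟩, hc, rfl⟩
    omega
  choose M hM using this
  refine ⟨Finset.univ.sup M, ?_⟩
  rintro k ⟨σ, u, hw, hk⟩
  funext j
  refine Subtype.ext ?_
  change (k j : Perm (Omega Z Λ j)) * (g j : Perm (Omega Z Λ j)) = g j * k j
  refine (Perm.Disjoint.commute fun x => ?_).eq
  rw [hk j]
  rcases x with l | ⟨i, n, m⟩
  · exact Or.inl rfl
  · by_cases hn : n < Finset.univ.sup M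
    · left
      simp [hw.perm_fix i n hn, hw.inner_fix i n hn]
    · right
      exact hM j i n m ((Finset.le_sup (Finset.mem_univ j)).trans (not_lt.1 hn))

lemma Theta_mem (β : Fin p → ℕ) (N : ℕ) : Theta Z Λ β N ∈ KSub κ Z Λ β :=
  diag_mem fun i n hn => by
    change theta _ _ n = n
    rw [theta_apply, if_pos hn]

lemma Theta_mul_self (β : Fin p → ℕ) (N : ℕ) : Theta Z Λ β N * Theta Z Λ β N = 1 := by
  rw [Theta, ← map_mul]
  convert map_one (diag Z Λ)
  funext i
  refine Subtype.ext (Equiv.ext fun n => ?_)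
  exact theta_theta _ _ n

lemma Theta_inv (β : Fin p → ℕ) (N : ℕ) : (Theta Z Λ β N)⁻¹ = Theta Z Λ β N :=
  inv_eq_of_mul_eq_one_left (Theta_mul_self β N)

/-- For large `N`, conjugation by `Θ_N^{[β]}` pushes a given element of `K^β` far away. -/
lemma exists_conj (β : Fin p → ℕ) {b : GGroup Z Λ} (hb : b ∈ KSub κ Z Λ β) :
    ∃ M, ∀ N, M ≤ N → Theta Z Λ β N * b * Theta Z Λ β N ∈ KSub κ Z Λ fun i => β i + N := by
  obtain ⟨σ, u, hw, hb⟩ := hb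
  have h1 : ∀ i, ∃ M, ∀ n, M ≤ n → σ i n = n := fun i => finite_nat_iff.1 (hw.perm_finitary i)
  have h2 : ∀ i, ∃ M, ∀ n, M ≤ n → u i n = 1 := fun i => finite_nat_iff.1 (hw.finite_support i)
  choose M hM using h1
  choose M' hM' using h2
  refine ⟨Finset.univ.sup M ⊔ Finset.univ.sup M', fun N hN => ?_⟩
  have e1 : ∀ i n, N ≤ n → σ i n = n := fun i n hn => hM i n <|
    ((Finset.le_sup (Finset.mem_univ i)).trans (le_sup_left.trans hN)).trans hn
  have e2 : ∀ i n, N ≤ n → u i n = 1 := fun i n hn => hM' i n <|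
    ((Finset.le_sup (Finset.mem_univ i)).trans (le_sup_right.trans hN)).trans hn
  have e3 : ∀ i n, n < β i + N → theta (β i) N n < β i ∨ N ≤ theta (β i) N n := by
    intro i n hn
    rw [theta_apply]; split_ifs <;> omega
  refine ⟨fun i => theta (β i) N * σ i * theta (β i) N, fun i n => u i (theta (β i) N n),
    ⟨?_, ?_, ?_, ?_, ?_⟩, ?_⟩
  · exact fun i => mul_mem (mul_mem (theta_mem _ _) (hw.1 i)) (theta_mem _ _)
  · exact fun i => (hw.2 i).preimage (theta (β i) N).injective.injOn
  · exact fun i n => hw.3 _ _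
  · intro i n hn
    have : σ i (theta (β i) N n) = theta (β i) N n :=
      (e3 i n hn).elim (hw.4 i _) (e1 i _)
    simp [this]
  · intro i n hn
    exact (e3 i n hn).elim (hw.5 i _) (e2 i _)
  · intro j
    change (wreathPerm Z Λ _ 1 j) * (b j : Perm (Omega Z Λ j)) * (wreathPerm Z Λ _ 1 j) = _
    rw [hb j, wreathPerm_mul, wreathPerm_mul]
    congr 1

lemma theta_step (a N : ℕ) : ∃ c d : finitary ℕ,
    (∀ n, n < a + N → (c : Perm ℕ) n = n) ∧ (∀ n, n < a + N → (d : Perm ℕ) n = n) ∧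
    theta a (N + 1) = d * theta a N * c := by
  let c : Perm ℕ :=
    { toFun := fun n => if n < a + N then n else if n = a + N then a + 2 * N else
        if n ≤ a + 2 * N then n - 1 else n
      invFun := fun n => if n < a + N then n else if n < a + 2 * N then n + 1 else
        if n = a + 2 * N then a + N else n
      left_inv := by intro n; dsimp only; split_ifs <;> omega
      right_inv := by intro n; dsimp only; split_ifs <;> omega }
  have hc : c ∈ finitary ℕ := finite_nat_iff.2 ⟨a + 2 * N + 1, fun n hn => by
    change (if n < a + N then n else if n = a + N then a + 2 * N else
        if n ≤ a + 2 * N then n - 1 else n) = n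
    split_ifs <;> omega⟩
  refine ⟨⟨c, hc⟩, ⟨theta a (N + 1) * c⁻¹ * theta a N,
    mul_mem (mul_mem (theta_mem _ _) (inv_mem hc)) (theta_mem _ _)⟩, ?_, ?_, ?_⟩
  · intro n hn
    change (if n < a + N then n else _) = n
    rw [if_pos hn]
  · intro n hn
    change theta a (N + 1) (if theta a N n < a + N then theta a N n else
      if theta a N n < a + 2 * N then theta a N n + 1 else
        if theta a N n = a + 2 * N then a + N else theta a N n) = n
    simp only [theta_apply]
    split_ifs <;> omega
  · ext n
    simp

/-- `Θ_{N'}^{[β]}` and `Θ_N^{[β]}` differ by elements of `K^{β + N}` on both sides. -/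
lemma Theta_le (κ : PairKind) (β : Fin p → ℕ) {N N' : ℕ} (h : N ≤ N') :
    ∃ k ∈ KSub κ Z Λ (fun i => β i + N), ∃ k' ∈ KSub κ Z Λ (fun i => β i + N),
      Theta Z Λ β N' = k * Theta Z Λ β N * k' := by
  induction N', h using Nat.le_induction with
  | base => exact ⟨1, one_mem _, 1, one_mem _, by simp⟩
  | succ N' hN ih =>
    obtain ⟨k, hk, k', hk', e⟩ := ih
    choose c d hc hd hcd using fun i => theta_step (β i) N'
    have hle : KSub κ Z Λ (fun i => β i + N') ≤ KSub κ Z Λ (fun i => β i + N) :=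
      KSub_anti fun i => by omega
    refine ⟨diag Z Λ d * k, mul_mem (hle (diag_mem hd)) hk,
      k' * diag Z Λ c, mul_mem hk' (hle (diag_mem hc)), ?_⟩
    have : Theta Z Λ β (N' + 1) = diag Z Λ d * Theta Z Λ β N' * diag Z Λ c := by
      rw [Theta, Theta, ← map_mul, ← map_mul]
      congr 1
      funext i
      exact Subtype.ext (hcd i)
    rw [this, e]
    group

lemma mk_eq_iff {A B : Subgroup (GGroup Z Λ)} {x y : GGroup Z Λ} :
    DoubleCoset.mk A B x = DoubleCoset.mk A B y ↔ ∃ a ∈ A, ∃ b ∈ B, y = a * x * b :=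
  Quotient.eq''.trans DoubleCoset.rel_iff

/-- The sequence of double cosets of `g Θ_N^{[β]} h` is eventually constant, and its limit does
not depend on the representatives `g`, `h`. -/
theorem exists_unique_limit {α β γ : Fin p → ℕ}
    (𝔤 : DoubleCoset.Quotient (KSub κ Z Λ γ : Set (GGroup Z Λ)) (KSub κ Z Λ β))
    (𝔥 : DoubleCoset.Quotient (KSub κ Z Λ β : Set (GGroup Z Λ)) (KSub κ Z Λ α)) :
    ∃! 𝔣 : DoubleCoset.Quotient (KSub κ Z Λ γ : Set (GGroup Z Λ)) (KSub κ Z Λ α),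
      ∀ g h : GGroup Z Λ, DoubleCoset.mk _ _ g = 𝔤 → DoubleCoset.mk _ _ h = 𝔥 →
        ∀ᶠ N in Filter.atTop, DoubleCoset.mk _ _ (g * Theta Z Λ β N * h) = 𝔣 := by
  obtain ⟨g₀, rfl⟩ := Quotient.exists_rep 𝔤
  obtain ⟨h₀, rfl⟩ := Quotient.exists_rep 𝔥
  -- stabilization for fixed representatives
  have stab : ∀ g h : GGroup Z Λ, ∃ M, ∀ N, M ≤ N →
      DoubleCoset.mk (KSub κ Z Λ γ) (KSub κ Z Λ α) (g * Theta Z Λ β N * h) =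
      DoubleCoset.mk (KSub κ Z Λ γ) (KSub κ Z Λ α) (g * Theta Z Λ β M * h) := by
    intro g h
    obtain ⟨M₁, h₁⟩ := exists_commute κ g
    obtain ⟨M₂, h₂⟩ := exists_commute κ h
    obtain ⟨M, hM⟩ : ∃ M, M = M₁ + M₂ + Finset.univ.sup α + Finset.univ.sup γ := ⟨_, rfl⟩
    refine ⟨M, fun N hN => ?_⟩
    obtain ⟨k, hk, k', hk', e⟩ := Theta_le (Z := Z) (Λ := Λ) κ β hN
    have hα : ∀ i, α i ≤ Finset.univ.sup α := fun i => Finset.le_sup (Finset.mem_univ i)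
    have hγ : ∀ i, γ i ≤ Finset.univ.sup γ := fun i => Finset.le_sup (Finset.mem_univ i)
    refine (mk_eq_iff.2 ⟨k, KSub_anti (fun i => ?_) hk, k', KSub_anti (fun i => ?_) hk', ?_⟩).symm
    · have := hγ i; omega
    · have := hα i; omega
    · have c₁ := h₁ k (KSub_anti (fun i => by omega) hk)
      have c₂ := h₂ k' (KSub_anti (fun i => by omega) hk')
      rw [e]
      calc g * (k * Theta Z Λ β M * k') * h = (g * k) * Theta Z Λ β M * (k' * h) := by group
        _ = _ := by rw [← c₁, c₂]; group
  -- independence of representatives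
  have indep : ∀ g h : GGroup Z Λ, ∀ b ∈ KSub κ Z Λ β, ∀ c ∈ KSub κ Z Λ β,
      ∀ᶠ N in Filter.atTop,
      DoubleCoset.mk (KSub κ Z Λ γ) (KSub κ Z Λ α) (g * b * Theta Z Λ β N * (c * h)) =
      DoubleCoset.mk (KSub κ Z Λ γ) (KSub κ Z Λ α) (g * Theta Z Λ β N * h) := by
    intro g h b hb c hc
    obtain ⟨M₁, h₁⟩ := exists_commute κ g
    obtain ⟨M₂, h₂⟩ := exists_commute κ (c * h)
    obtain ⟨M₃, h₃⟩ := exists_conj β hb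
    obtain ⟨M₄, h₄⟩ := exists_conj β hc
    have hα : ∀ i, α i ≤ Finset.univ.sup α := fun i => Finset.le_sup (Finset.mem_univ i)
    have hγ : ∀ i, γ i ≤ Finset.univ.sup γ := fun i => Finset.le_sup (Finset.mem_univ i)
    filter_upwards [Filter.eventually_ge_atTop
      (M₁ + M₂ + M₃ + M₄ + Finset.univ.sup α + Finset.univ.sup γ)] with N hN
    have hb' := h₃ N (by omega)
    have hc' := h₄ N (by omega)
    have c₁ := h₁ _ (KSub_anti (fun i => by omega) hc')
    have c₂ := h₂ _ (KSub_anti (fun i => by omega) hb')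
    have hT := Theta_mul_self (Z := Z) (Λ := Λ) β N
    refine (mk_eq_iff.2 ⟨_, KSub_anti (fun i => ?_) hc', _, KSub_anti (fun i => ?_) hb', ?_⟩).symm
    · have := hγ i; omega
    · have := hα i; omega
    · generalize Theta Z Λ β N = T at *
      have e1 : b * T = T * (T * b * T) := by
        rw [← mul_assoc, ← mul_assoc, hT, one_mul]
      have e2 : T * c = (T * c * T) * T := by
        rw [mul_assoc (T * c), hT, mul_one]
      calc g * b * T * (c * h) = g * (b * T) * (c * h) := by group
        _ = g * T * ((T * b * T) * (c * h)) := by rw [e1]; group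
        _ = g * (T * c) * h * (T * b * T) := by rw [c₂]; group
        _ = (g * (T * c * T)) * T * h * (T * b * T) := by
          conv_lhs => rw [e2]
          group
        _ = _ := by rw [← c₁]; group
  obtain ⟨M, hM⟩ := stab g₀ h₀
  refine ⟨DoubleCoset.mk _ _ (g₀ * Theta Z Λ β M * h₀), ?_, ?_⟩
  · intro g h hg hh
    obtain ⟨a, ha, b, hb, rfl⟩ := mk_eq_iff.1 hg.symm
    obtain ⟨c, hc, d, hd, rfl⟩ := mk_eq_iff.1 hh.symm
    filter_upwards [indep g₀ h₀ b hb c hc, Filter.eventually_ge_atTop M] with N hN hN'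
    rw [← hM N hN', ← hN]
    exact (mk_eq_iff.2 ⟨a, ha, d, hd, by group⟩).symm
  · intro 𝔣 h𝔣
    obtain ⟨N, hN, hN'⟩ := ((h𝔣 g₀ h₀ rfl rfl).and (Filter.eventually_ge_atTop M)).exists
    rw [← hN, hM N hN']

/-- The product `𝔤 ∘ 𝔥` of double cosets: the limit of the double cosets of
`g Θ_N^{[β]} h`, where `g ∈ 𝔤` and `h ∈ 𝔥`. -/
noncomputable def cosetMul {α β γ : Fin p → ℕ}
    (𝔤 : DoubleCoset.Quotient (KSub κ Z Λ γ : Set (GGroup Z Λ)) (KSub κ Z Λ β))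
    (𝔥 : DoubleCoset.Quotient (KSub κ Z Λ β : Set (GGroup Z Λ)) (KSub κ Z Λ α)) :
    DoubleCoset.Quotient (KSub κ Z Λ γ : Set (GGroup Z Λ)) (KSub κ Z Λ α) :=
  (exists_unique_limit 𝔤 𝔥).choose

lemma cosetMul_spec {α β γ : Fin p → ℕ} (g h : GGroup Z Λ) :
    ∀ᶠ N in Filter.atTop,
      DoubleCoset.mk (KSub κ Z Λ γ) (KSub κ Z Λ α) (g * Theta Z Λ β N * h) =
      cosetMul (DoubleCoset.mk (KSub κ Z Λ γ) (KSub κ Z Λ β) g)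
        (DoubleCoset.mk (KSub κ Z Λ β) (KSub κ Z Λ α) h) :=
  (exists_unique_limit _ _).choose_spec.1 g h rfl rfl

lemma cosetMul_eq {α β γ : Fin p → ℕ} {g h f : GGroup Z Λ} (N₀ : ℕ)
    (H : ∀ N, N₀ ≤ N → DoubleCoset.mk (KSub κ Z Λ γ) (KSub κ Z Λ α) (g * Theta Z Λ β N * h) =
      DoubleCoset.mk (KSub κ Z Λ γ) (KSub κ Z Λ α) f) :
    cosetMul (DoubleCoset.mk (KSub κ Z Λ γ) (KSub κ Z Λ β) g)
        (DoubleCoset.mk (KSub κ Z Λ β) (KSub κ Z Λ α) h) =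
      DoubleCoset.mk (KSub κ Z Λ γ) (KSub κ Z Λ α) f := by
  obtain ⟨N, hN, hN'⟩ :=
    ((cosetMul_spec (κ := κ) (α := α) (β := β) (γ := γ) g h).and
      (Filter.eventually_ge_atTop N₀)).exists
  rw [← hN, H N hN']

lemma cosetMul_eq_of_commute {α β γ : Fin p → ℕ} {g h : GGroup Z Λ} {W N₀ : ℕ}
    (hα : ∀ i, α i ≤ W) (hγ : ∀ i, γ i ≤ W) (hW : W ≤ N₀)
    (hg : ∀ k ∈ KSub κ Z Λ fun _ => W, k * g = g * k)
    (hh : ∀ k ∈ KSub κ Z Λ fun _ => W, k * h = h * k) :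
    cosetMul (DoubleCoset.mk (KSub κ Z Λ γ) (KSub κ Z Λ β) g)
        (DoubleCoset.mk (KSub κ Z Λ β) (KSub κ Z Λ α) h) =
      DoubleCoset.mk (KSub κ Z Λ γ) (KSub κ Z Λ α) (g * Theta Z Λ β N₀ * h) := by
  refine cosetMul_eq N₀ fun N hN => ?_
  obtain ⟨k, hk, k', hk', e⟩ := Theta_le (Z := Z) (Λ := Λ) κ β hN
  have c₁ := hg k (KSub_anti (fun i => by omega) hk)
  have c₂ := hh k' (KSub_anti (fun i => by omega) hk')
  refine (mk_eq_iff.2 ⟨k, KSub_anti (fun i => ?_) hk, k', KSub_anti (fun i => ?_) hk', ?_⟩).symm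
  · have := hγ i; omega
  · have := hα i; omega
  · rw [e]
    calc g * (k * Theta Z Λ β N₀ * k') * h = (g * k) * Theta Z Λ β N₀ * (k' * h) := by group
      _ = _ := by rw [← c₁, c₂]; group

lemma theta_cross {a c W M : ℕ} (ha : a ≤ W) (hc : c ≤ W) (hM : 10 * W ≤ M) :
    ∃ e d : finitary ℕ, (∀ n, n < W → (e : Perm ℕ) n = n) ∧ (∀ n, n < W → (d : Perm ℕ) n = n) ∧
      (∀ n, n < W → theta c (3 * W) ((d : Perm ℕ) (theta c (3 * W) n)) = n) ∧
      theta a M = d * theta a W * e := by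
  let f : ℕ → ℕ := fun n =>
    if a + W ≤ n ∧ n < a + 2 * W then n + (M - W) else
    if a + M ≤ n ∧ n < a + M + W then n - (M - W) else
    if c + 3 * W ≤ n ∧ n < c + 4 * W then n + M else
    if c + 3 * W + M ≤ n ∧ n < c + 4 * W + M then n - M else n
  have hf : Function.Involutive f := by
    intro n; simp only [f]; split_ifs <;> omega
  let e : Perm ℕ := hf.toPerm
  have he : ∀ n, e n = f n := fun n => rfl
  have hee : ∀ n, e (e n) = n := hf
  have hemem : e ∈ finitary ℕ := finite_nat_iff.2 ⟨c + 4 * W + M + a, fun n hn => by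
    rw [he]; simp only [f]; split_ifs <;> omega⟩
  have hd : ∀ n, n < W → theta a M (e (theta a W n)) = n := by
    intro n hn
    have h1 : theta a W n = if n < a then n else n + W := by
      rw [theta_apply]; split_ifs <;> omega
    rw [h1]
    by_cases h : n < a
    · rw [if_pos h, he]
      have : f n = n := by simp only [f]; split_ifs <;> omega
      rw [this, theta_apply, if_pos h]
    · rw [if_neg h, he]
      have : f (n + W) = n + M := by simp only [f]; split_ifs <;> omega
      rw [this, theta_apply]; split_ifs <;> omega
  refine ⟨⟨e, hemem⟩, ⟨theta a M * e * theta a W,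
    mul_mem (mul_mem (theta_mem _ _) hemem) (theta_mem _ _)⟩, ?_, ?_, ?_, ?_⟩
  · intro n hn
    change f n = n
    simp only [f]; split_ifs <;> omega
  · exact hd
  · intro n hn
    change theta c (3 * W) (theta a M (e (theta a W (theta c (3 * W) n)))) = n
    by_cases h : n < c
    · have h1 : theta c (3 * W) n = n := by rw [theta_apply, if_pos h]
      rw [h1, hd n hn, h1]
    · have h1 : theta c (3 * W) n = n + 3 * W := by rw [theta_apply]; split_ifs <;> omega
      have h2 : theta a W (n + 3 * W) = n + 3 * W := by rw [theta_apply]; split_ifs <;> omega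
      have h3 : f (n + 3 * W) = n + 3 * W + M := by simp only [f]; split_ifs <;> omega
      have h4 : theta a M (n + 3 * W + M) = n + 3 * W := by rw [theta_apply]; split_ifs <;> omega
      rw [h1, h2, he, h3, h4, ← h1, theta_theta]
  · ext n
    simp [hee]

theorem cosetMul_assoc {α β γ δ : Fin p → ℕ}
    (𝔤 : DoubleCoset.Quotient (KSub κ Z Λ δ : Set (GGroup Z Λ)) (KSub κ Z Λ γ))
    (𝔥 : DoubleCoset.Quotient (KSub κ Z Λ γ : Set (GGroup Z Λ)) (KSub κ Z Λ β))
    (𝔣 : DoubleCoset.Quotient (KSub κ Z Λ β : Set (GGroup Z Λ)) (KSub κ Z Λ α)) :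
    cosetMul (cosetMul 𝔤 𝔥) 𝔣 = cosetMul 𝔤 (cosetMul 𝔥 𝔣) := by
  obtain ⟨g, rfl⟩ := Quotient.exists_rep 𝔤
  obtain ⟨h, rfl⟩ := Quotient.exists_rep 𝔥
  obtain ⟨f, rfl⟩ := Quotient.exists_rep 𝔣
  change cosetMul (cosetMul (DoubleCoset.mk _ _ g) (DoubleCoset.mk _ _ h)) (DoubleCoset.mk _ _ f) =
    cosetMul (DoubleCoset.mk _ _ g) (cosetMul (DoubleCoset.mk _ _ h) (DoubleCoset.mk _ _ f))
  obtain ⟨M₁, h₁⟩ := exists_commute κ g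
  obtain ⟨M₂, h₂⟩ := exists_commute κ h
  obtain ⟨M₃, h₃⟩ := exists_commute κ f
  obtain ⟨W, hW⟩ : ∃ W, W = M₁ + M₂ + M₃ + Finset.univ.sup α + Finset.univ.sup β +
    Finset.univ.sup γ + Finset.univ.sup δ := ⟨_, rfl⟩
  have hα : ∀ i, α i ≤ W := fun i => by
    have : α i ≤ Finset.univ.sup α := Finset.le_sup (Finset.mem_univ i)
    omega
  have hβ : ∀ i, β i ≤ W := fun i => by
    have : β i ≤ Finset.univ.sup β := Finset.le_sup (Finset.mem_univ i)
    omega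
  have hγ : ∀ i, γ i ≤ W := fun i => by
    have : γ i ≤ Finset.univ.sup γ := Finset.le_sup (Finset.mem_univ i)
    omega
  have hδ : ∀ i, δ i ≤ W := fun i => by
    have : δ i ≤ Finset.univ.sup δ := Finset.le_sup (Finset.mem_univ i)
    omega
  have cg : ∀ k ∈ KSub κ Z Λ fun _ => W, k * g = g * k :=
    fun k hk => h₁ k (KSub_anti (fun i => by omega) hk)
  have ch : ∀ k ∈ KSub κ Z Λ fun _ => W, k * h = h * k :=
    fun k hk => h₂ k (KSub_anti (fun i => by omega) hk)
  have cf : ∀ k ∈ KSub κ Z Λ fun _ => W, k * f = f * k :=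
    fun k hk => h₃ k (KSub_anti (fun i => by omega) hk)
  rw [cosetMul_eq_of_commute (N₀ := 3 * W) hβ hδ (by omega) cg ch,
    cosetMul_eq_of_commute hα hγ le_rfl ch cf]
  set x := Theta Z Λ γ (3 * W) with hx
  set y := Theta Z Λ β W with hy
  trans DoubleCoset.mk (KSub κ Z Λ δ) (KSub κ Z Λ α) (g * x * h * y * f)
  · refine cosetMul_eq (10 * W) fun M hM => ?_
    choose e d he hd hxd hed using fun i => theta_cross (hβ i) (hγ i) hM
    have hdm : diag Z Λ d ∈ KSub κ Z Λ fun _ => W := diag_mem hd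
    have hem : diag Z Λ e ∈ KSub κ Z Λ fun _ => W := diag_mem he
    have hxm : x * diag Z Λ d * x ∈ KSub κ Z Λ fun _ => W := by
      rw [hx, Theta, ← map_mul, ← map_mul]
      exact diag_mem hxd
    have hy' : Theta Z Λ β M = diag Z Λ d * y * diag Z Λ e := by
      rw [hy, Theta, Theta, ← map_mul, ← map_mul]
      congr 1
      funext i
      exact Subtype.ext (hed i)
    have hT : x * x = 1 := Theta_mul_self γ _
    refine (mk_eq_iff.2 ⟨_, KSub_anti hδ hxm, _, KSub_anti hα hem, ?_⟩).symm
    have c₁ := cg _ hxm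
    have c₂ := ch _ hdm
    have c₃ := cf _ hem
    rw [hy']
    generalize diag Z Λ d = D at *
    generalize diag Z Λ e = E at *
    have e1 : x * D = x * D * x * x := by rw [mul_assoc (x * D), hT, mul_one]
    calc g * x * h * (D * y * E) * f = g * x * (h * D) * y * (E * f) := by group
      _ = g * (x * D) * h * y * (f * E) := by rw [← c₂, c₃]; group
      _ = (g * (x * D * x)) * x * h * y * (f * E) := by
        conv_lhs => rw [e1]
        group
      _ = _ := by rw [← c₁]; group
  · symm
    refine cosetMul_eq (3 * W) fun N hN => ?_
    obtain ⟨k, hk, k', hk', e⟩ := Theta_le (Z := Z) (Λ := Λ) κ γ hN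
    have c₁ := cg k (KSub_anti (fun i => by omega) hk)
    have c₂ := ch k' (KSub_anti (fun i => by omega) hk')
    have c₃ := cf k' (KSub_anti (fun i => by omega) hk')
    have c₄ : k' * y = y * k' := by
      obtain ⟨σ, u, hw, hk''⟩ := hk'
      funext j
      refine Subtype.ext ?_
      change (k' j : Perm (Omega Z Λ j)) * (y j : Perm (Omega Z Λ j)) = y j * k' j
      refine (Perm.Disjoint.commute fun z => ?_).eq
      rw [hk'' j]
      rcases z with l | ⟨i, n, m⟩
      · exact Or.inl rfl
      · by_cases hn : n < γ i + 3 * W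
        · left
          simp [hw.perm_fix i n hn, hw.inner_fix i n hn]
        · right
          have hb := hβ i
          have : theta (β i) W n = n := by rw [theta_apply]; split_ifs <;> omega
          change wreathPerm Z Λ (fun i => theta (β i) W) 1 j _ = _
          simp [this]
    refine (mk_eq_iff.2 ⟨k, KSub_anti (fun i => ?_) hk, k', KSub_anti (fun i => ?_) hk', ?_⟩).symm
    · have := hδ i; omega
    · have := hα i; omega
    · rw [e, ← hx]
      calc g * (k * x * k') * (h * y * f) = (g * k) * x * (k' * h) * y * f := by group
        _ = k * g * x * h * (k' * y) * f := by rw [← c₁, c₂]; group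
        _ = k * g * x * h * y * (k' * f) := by rw [c₄]; group
        _ = _ := by rw [c₃]; group

lemma one_cosetMul {α β : Fin p → ℕ}
    (𝔥 : DoubleCoset.Quotient (KSub κ Z Λ β : Set (GGroup Z Λ)) (KSub κ Z Λ α)) :
    cosetMul (DoubleCoset.mk (KSub κ Z Λ β) (KSub κ Z Λ β) 1) 𝔥 = 𝔥 := by
  obtain ⟨h, rfl⟩ := Quotient.exists_rep 𝔥
  exact cosetMul_eq 0 fun N _ =>
    (mk_eq_iff.2 ⟨_, Theta_mem β N, 1, one_mem _, by group⟩).symm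

lemma cosetMul_one {α β : Fin p → ℕ}
    (𝔥 : DoubleCoset.Quotient (KSub κ Z Λ β : Set (GGroup Z Λ)) (KSub κ Z Λ α)) :
    cosetMul 𝔥 (DoubleCoset.mk (KSub κ Z Λ α) (KSub κ Z Λ α) 1) = 𝔥 := by
  obtain ⟨h, rfl⟩ := Quotient.exists_rep 𝔥
  exact cosetMul_eq 0 fun N _ =>
    (mk_eq_iff.2 ⟨1, one_mem _, _, Theta_mem α N, by group⟩).symm

end Product

/-- The objects of the train `𝕋(G, K)`: multi-indices `α = (α_1, …, α_p)`. -/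
@[ext]
structure Train (κ : PairKind) (Z : Matrix (Fin q) (Fin p) ℕ) (Λ : Fin q → ℕ) : Type where
  idx : Fin p → ℕ

/-- The train `𝕋(G, K)`: morphisms `α → β` are the elements of `K^β \ G / K^α`. -/
noncomputable instance (κ : PairKind) (Z : Matrix (Fin q) (Fin p) ℕ) (Λ : Fin q → ℕ) :
    Category.{0} (Train κ Z Λ) where
  Hom α β := DoubleCoset.Quotient (KSub κ Z Λ β.idx : Set (GGroup Z Λ)) (KSub κ Z Λ α.idx)
  id _ := DoubleCoset.mk _ _ 1
  comp 𝔥 𝔤 := cosetMul 𝔤 𝔥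
  id_comp 𝔥 := cosetMul_one 𝔥
  comp_id 𝔥 := one_cosetMul 𝔥
  assoc 𝔣 𝔥 𝔤 := (cosetMul_assoc 𝔤 𝔥 𝔣).symm

section Reps

variable {κ : PairKind} {Z : Matrix (Fin q) (Fin p) ℕ} {Λ : Fin q → ℕ}

/-- The morphism `α → β` of the train which is the double coset of `g`. -/
def Train.coset (α β : Train κ Z Λ) (g : GGroup Z Λ) : α ⟶ β :=
  DoubleCoset.mk (KSub κ Z Λ β.idx) (KSub κ Z Λ α.idx) g

/-- The involution `𝔤 ↦ 𝔤^□` of the train, induced by `g ↦ g⁻¹`. -/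
def Train.square {α β : Train κ Z Λ} (𝔤 : α ⟶ β) : β ⟶ α :=
  Quotient.lift (s := DoubleCoset.setoid _ _) (fun g => Train.coset β α g⁻¹) (by
    intro a b hab
    obtain ⟨x, hx, y, hy, rfl⟩ := DoubleCoset.rel_iff.1 hab
    exact mk_eq_iff.2 ⟨y⁻¹, inv_mem hy, x⁻¹, inv_mem hx, by group⟩) 𝔤

section Fixed

variable {H : Type u} [NormedAddCommGroup H] [InnerProductSpace ℂ H]

/-- The subspace `H^α` of `K^α`-fixed vectors. -/
def fixedSubspace (ρ : GGroup Z Λ →* (H ≃ₗᵢ[ℂ] H)) (α : Train κ Z Λ) : Submodule ℂ H where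
  carrier := {v | ∀ k ∈ KSub κ Z Λ α.idx, ρ k v = v}
  zero_mem' := by simp
  add_mem' := by
    intro v w hv hw k hk
    rw [map_add, hv k hk, hw k hk]
  smul_mem' := by
    intro c v hv k hk
    rw [map_smul, hv k hk]

lemma isClosed_fixedSubspace (ρ : GGroup Z Λ →* (H ≃ₗᵢ[ℂ] H)) (α : Train κ Z Λ) :
    IsClosed (fixedSubspace ρ α : Set H) := by
  have : (fixedSubspace ρ α : Set H) = ⋂ k ∈ KSub κ Z Λ α.idx, {v | ρ k v = v} := by
    ext v
    simp [fixedSubspace]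
  rw [this]
  exact isClosed_biInter fun k _ => isClosed_eq (ρ k).continuous continuous_id

variable [CompleteSpace H]

instance (ρ : GGroup Z Λ →* (H ≃ₗᵢ[ℂ] H)) (α : Train κ Z Λ) :
    CompleteSpace (fixedSubspace ρ α) :=
  (isClosed_fixedSubspace ρ α).completeSpace_coe

/-- The operator `ρ̄_{α,β}(g) = P^β ρ(g) : H^α → H^β`, where `P^β` is the orthogonal projection
to `H^β`. -/
noncomputable def trainOp (ρ : GGroup Z Λ →* (H ≃ₗᵢ[ℂ] H)) (α β : Train κ Z Λ) (g : GGroup Z Λ) :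
    fixedSubspace ρ α →L[ℂ] fixedSubspace ρ β :=
  (fixedSubspace ρ β).orthogonalProjectionOnto ∘L
    ((ρ g).toContinuousLinearEquiv : H →L[ℂ] H) ∘L (fixedSubspace ρ α).subtypeL

/-- `ρ̄_{α,β}(g)` depends only on the double coset of `g`. -/
lemma trainOp_eq (ρ : GGroup Z Λ →* (H ≃ₗᵢ[ℂ] H)) (α β : Train κ Z Λ) {g g' : GGroup Z Λ}
    (h : DoubleCoset.setoid (KSub κ Z Λ β.idx : Set (GGroup Z Λ)) (KSub κ Z Λ α.idx) g g') :
    trainOp ρ α β g = trainOp ρ α β g' := by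
  obtain ⟨a, ha, b, hb, rfl⟩ := DoubleCoset.rel_iff.1 h
  ext v
  have hv : ρ b v = v := v.2 b hb
  have e : ρ (a * g * b) v = ρ a (ρ g v) := by
    rw [map_mul, map_mul]
    change ρ a (ρ g (ρ b v)) = _
    rw [hv]
  refine congrArg Subtype.val (?_ : (fixedSubspace ρ β).orthogonalProjectionOnto (ρ g v) =
    (fixedSubspace ρ β).orthogonalProjectionOnto (ρ (a * g * b) v))
  rw [e, ← sub_eq_zero, ← map_sub, Submodule.orthogonalProjectionOnto_eq_zero_iff,
    Submodule.mem_orthogonal]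
  intro w hw
  rw [inner_sub_right, sub_eq_zero]
  conv_rhs => rw [← hw a ha]
  rw [LinearIsometryEquiv.inner_map_map]

end Fixed

/-- A unitary representation of `G` in a (complex) Hilbert space which is `K`-admissible: the
union of the subspaces `H^α` is dense. -/
structure AdmissibleRep (κ : PairKind) (Z : Matrix (Fin q) (Fin p) ℕ) (Λ : Fin q → ℕ) :
    Type (u + 1) where
  H : Type u
  [normedAddCommGroup : NormedAddCommGroup H]
  [innerProductSpace : InnerProductSpace ℂ H]
  [completeSpace : CompleteSpace H]
  ρ : GGroup Z Λ →* (H ≃ₗᵢ[ℂ] H)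
  admissible : Dense (⋃ α : Train κ Z Λ, (fixedSubspace ρ α : Set H))

attribute [instance] AdmissibleRep.normedAddCommGroup AdmissibleRep.innerProductSpace
  AdmissibleRep.completeSpace

/-- Unitary equivalence of `K`-admissible representations of `G`. -/
instance AdmissibleRep.setoid (κ : PairKind) (Z : Matrix (Fin q) (Fin p) ℕ) (Λ : Fin q → ℕ) :
    Setoid (AdmissibleRep.{u} κ Z Λ) where
  r π π' := ∃ U : π.H ≃ₗᵢ[ℂ] π'.H, ∀ g v, U (π.ρ g v) = π'.ρ g (U v)
  iseqv :=
    { refl := fun π => ⟨LinearIsometryEquiv.refl ℂ _, fun _ _ => rfl⟩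
      symm := by
        rintro π π' ⟨U, hU⟩
        refine ⟨U.symm, fun g v => ?_⟩
        rw [LinearIsometryEquiv.symm_apply_eq, hU, LinearIsometryEquiv.apply_symm_apply]
      trans := by
        rintro π π' π'' ⟨U, hU⟩ ⟨U', hU'⟩
        refine ⟨U.trans U', fun g v => ?_⟩
        simp [hU, hU'] }

/-- A family of Hilbert spaces `V_α` indexed by the objects of the train, with a bounded operator
`V_α → V_β` for every morphism `α → β`. -/
structure OperatorFamily (κ : PairKind) (Z : Matrix (Fin q) (Fin p) ℕ) (Λ : Fin q → ℕ) :
    Type (u + 1) where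
  V : Train κ Z Λ → Type u
  [normedAddCommGroup : ∀ α, NormedAddCommGroup (V α)]
  [innerProductSpace : ∀ α, InnerProductSpace ℂ (V α)]
  [completeSpace : ∀ α, CompleteSpace (V α)]
  map : ∀ {α β : Train κ Z Λ}, (α ⟶ β) → (V α →L[ℂ] V β)

attribute [instance] OperatorFamily.normedAddCommGroup OperatorFamily.innerProductSpace
  OperatorFamily.completeSpace

/-- The family is a `*`-representation of the train (a functor compatible with the involution)
by operators of norm at most `1`. -/
structure OperatorFamily.IsContractiveStarRep (T : OperatorFamily.{u} κ Z Λ) : Prop where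
  map_id : ∀ α, T.map (𝟙 α) = ContinuousLinearMap.id ℂ (T.V α)
  map_comp : ∀ {α β γ : Train κ Z Λ} (𝔥 : α ⟶ β) (𝔤 : β ⟶ γ),
    T.map (𝔥 ≫ 𝔤) = T.map 𝔤 ∘L T.map 𝔥
  map_square : ∀ {α β : Train κ Z Λ} (𝔤 : α ⟶ β),
    T.map (Train.square 𝔤) = ContinuousLinearMap.adjoint (T.map 𝔤)
  norm_le_one : ∀ {α β : Train κ Z Λ} (𝔤 : α ⟶ β), ‖T.map 𝔤‖ ≤ 1

/-- The `*`-representations of the train by contractions. -/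
def StarRep (κ : PairKind) (Z : Matrix (Fin q) (Fin p) ℕ) (Λ : Fin q → ℕ) : Type (u + 1) :=
  {T : OperatorFamily.{u} κ Z Λ // T.IsContractiveStarRep}

/-- Unitary equivalence of `*`-representations of the train. -/
instance StarRep.setoid (κ : PairKind) (Z : Matrix (Fin q) (Fin p) ℕ) (Λ : Fin q → ℕ) :
    Setoid (StarRep.{u} κ Z Λ) where
  r T T' := ∃ U : ∀ α, T.1.V α ≃ₗᵢ[ℂ] T'.1.V α, ∀ (α β : Train κ Z Λ) (𝔤 : α ⟶ β) (v : T.1.V α),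
    U β (T.1.map 𝔤 v) = T'.1.map 𝔤 (U α v)
  iseqv :=
    { refl := fun T => ⟨fun _ => LinearIsometryEquiv.refl ℂ _, fun _ _ _ _ => rfl⟩
      symm := by
        rintro T T' ⟨U, hU⟩
        refine ⟨fun α => (U α).symm, fun α β 𝔤 v => ?_⟩
        rw [LinearIsometryEquiv.symm_apply_eq, hU, LinearIsometryEquiv.apply_symm_apply]
      trans := by
        rintro T T' T'' ⟨U, hU⟩ ⟨U', hU'⟩
        refine ⟨fun α => (U α).trans (U' α), fun α β 𝔤 v => ?_⟩
        simp [hU, hU'] }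

/-- The family of the subspaces `H^α` and the operators `ρ̄_{α,β}(𝔤) : H^α → H^β` constructed from
a `K`-admissible unitary representation of `G`. -/
noncomputable def AdmissibleRep.train (π : AdmissibleRep.{u} κ Z Λ) : OperatorFamily.{u} κ Z Λ where
  V α := fixedSubspace π.ρ α
  map {α β} 𝔤 := Quotient.lift (s := DoubleCoset.setoid _ _) (trainOp π.ρ α β)
    (fun _ _ h => trainOp_eq π.ρ α β h) 𝔤

end Reps

end SymTrain

/-!
The operators `ρ(Θ_N^{[β]})` converge weakly to `P^β`. Indeed, for `b ∈ K^β` the elements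
`Θ_N b Θ_N⁻¹` eventually fix each vector of the dense space `⋃ H^α`, so the vectors `ρ(b) v - v` are
sent weakly to `0`; whatever is orthogonal to all of them lies in `H^β`. Passing to the limit in
`ρ(g Θ_N h)` shows that `ρ̄` is multiplicative.

The representation `ρ` is recovered from `ρ̄`, because the inner products of the total family of
vectors `ρ(g) v` with `v ∈ H^α` are matrix coefficients of the operators of `ρ̄`. Conversely, a
contractive `*`-representation `T` prescribes inner products `⟨T(h⁻¹g) v, w⟩` of formal vectors
`ρ(g) v` and `ρ(h) w`. Given finitely many `g`, choose `γ` so large that `K^γ` commutes with all of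
them; then these are the inner products of the vectors `T(g) v` of `V_γ`, where `g` stands for its
double coset, so that they form a positive semidefinite kernel. In the Hilbert space it generates,
the weak limit above shows that `P^α` maps the copy of `V_γ` to that of `V_α` through the double
coset of `1`, whence `H^α = V_α`.
-/

namespace SymTrain

open Equiv CategoryTheory Filter Topology

universe v

section Gram

open scoped ComplexOrder

lemma posSemidef_of_forall_finset {R X : Type*} [Ring R] [PartialOrder R] [StarRing R]
    {K : Matrix X X R}
    (hK : ∀ s : Finset X, (K.submatrix ((↑) : s → X) (↑)).PosSemidef) : K.PosSemidef := by
  classical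
  refine ⟨Matrix.IsHermitian.ext fun x y => ?_, fun f => ?_⟩
  · exact (hK {x, y}).1.apply ⟨x, by simp⟩ ⟨y, by simp⟩
  · simp only [← Finsupp.sum_subtypeDomain_index (v := f) (p := (· ∈ f.support)) fun _ => id]
    exact (hK f.support).2 _

variable {𝕜 : Type*} [RCLike 𝕜]

lemma eq_of_inner_eq_of_dense_span {X H : Type*} [NormedAddCommGroup H] [InnerProductSpace 𝕜 H]
    {a : X → H} (ha : Dense (Submodule.span 𝕜 (Set.range a) : Set H)) {v w : H}
    (h : ∀ x, inner 𝕜 v (a x) = inner 𝕜 w (a x)) : v = w := by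
  refine ext_inner_right 𝕜 fun y => ?_
  refine DFunLike.congr_fun (f := innerSL 𝕜 v) (g := innerSL 𝕜 w)
    (ContinuousLinearMap.ext_on ha ?_) y
  rintro _ ⟨x, rfl⟩
  exact h x

lemma denseRange_linearCombination {X H : Type*} [NormedAddCommGroup H] [InnerProductSpace 𝕜 H]
    {a : X → H} (ha : Dense (Submodule.span 𝕜 (Set.range a) : Set H)) :
    DenseRange (Finsupp.linearCombination 𝕜 a) := by
  rwa [DenseRange, ← LinearMap.coe_range, Finsupp.range_linearCombination]

theorem exists_linearIsometryEquiv_of_gram_eq {X H H' : Type*}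
    [NormedAddCommGroup H] [InnerProductSpace 𝕜 H] [CompleteSpace H]
    [NormedAddCommGroup H'] [InnerProductSpace 𝕜 H'] [CompleteSpace H']
    {a : X → H} {b : X → H'} (ha : Dense (Submodule.span 𝕜 (Set.range a) : Set H))
    (hb : Dense (Submodule.span 𝕜 (Set.range b) : Set H'))
    (hab : Matrix.gram 𝕜 a = Matrix.gram 𝕜 b) : ∃ U : H ≃ₗᵢ[𝕜] H', ∀ x, U (a x) = b x := by
  have norm_eq (f : X →₀ 𝕜) :
      ‖Finsupp.linearCombination 𝕜 b f‖ = ‖Finsupp.linearCombination 𝕜 a f‖ := by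
    have inner_eq (x y : X) : inner 𝕜 (a x) (a y) = inner 𝕜 (b x) (b y) := congrFun₂ hab x y
    simp only [@norm_eq_sqrt_re_inner 𝕜, Finsupp.linearCombination_apply, Finsupp.sum_inner,
      Finsupp.inner_sum, inner_smul_left, inner_smul_right, inner_eq]
  refine ⟨(LinearEquiv.refl 𝕜 (X →₀ 𝕜)).extendOfIsometry _ _
    (denseRange_linearCombination ha) (denseRange_linearCombination hb) norm_eq, fun x => ?_⟩
  simpa only [Finsupp.linearCombination_single, one_smul, LinearEquiv.refl_apply] using
    LinearEquiv.extendOfIsometry_eq (LinearEquiv.refl 𝕜 (X →₀ 𝕜)) _ _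
      (denseRange_linearCombination ha) (denseRange_linearCombination hb) norm_eq
      (Finsupp.single x 1)

lemma posSemidef_map_smul_id {X : Type*} {K : Matrix X X 𝕜} (hK : K.PosSemidef) :
    (K.map (· • ContinuousLinearMap.id 𝕜 𝕜)).PosSemidef := by
  have posSemidef_iff :=
    RKHS.posSemidef_tfae (K := K.map (· • ContinuousLinearMap.id 𝕜 𝕜)) |>.out 0 2
  refine posSemidef_iff.2 ⟨Matrix.IsHermitian.ext fun x y => ?_, fun f => ?_⟩
  · rw [Matrix.map_apply, Matrix.map_apply, star_smul, hK.1.apply,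
      ContinuousLinearMap.star_eq_adjoint, ContinuousLinearMap.adjoint_id]
  · convert (RCLike.nonneg_iff.1 (hK.2 f)).1 using 2
    refine Finsupp.sum_congr fun x _ => Finsupp.sum_congr fun y _ => ?_
    simp only [Matrix.map_apply, smul_apply, ContinuousLinearMap.id_apply, smul_eq_mul,
      RCLike.inner_apply, map_mul, RCLike.star_def, ← hK.1.apply x y]
    ring

theorem exists_gram_eq_of_posSemidef {X : Type u} {𝕜 : Type v} [RCLike 𝕜] {K : Matrix X X 𝕜}
    (hK : K.PosSemidef) :
    ∃ (H : Type (max u v)) (_ : NormedAddCommGroup H) (_ : InnerProductSpace 𝕜 H)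
      (_ : CompleteSpace H) (a : X → H),
        Matrix.gram 𝕜 a = K ∧ Dense (Submodule.span 𝕜 (Set.range a) : Set H) := by
  let K' : Matrix X X (𝕜 →L[𝕜] 𝕜) := K.map (· • ContinuousLinearMap.id 𝕜 𝕜)
  have : Fact K'.PosSemidef := ⟨posSemidef_map_smul_id hK⟩
  refine ⟨RKHS.OfKernel K', inferInstance, inferInstance, inferInstance,
    fun x => RKHS.kerFun (RKHS.OfKernel K') x 1, ?_, ?_⟩
  · ext x y
    rw [Matrix.gram_apply, ← RKHS.kernel_inner, RKHS.OfKernel.kernel_ofKernel]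
    simpa [K'] using hK.1.apply x y
  · refine (Submodule.dense_iff_topologicalClosure_eq_top.2 (RKHS.kerFun_dense _)).mono
      (Submodule.span_le.2 ?_)
    rintro _ ⟨x, v, rfl⟩
    have : v = v • 1 := by simp
    rw [this, map_smul]
    exact Submodule.smul_mem _ v (Submodule.subset_span ⟨x, rfl⟩)

end Gram

section WeakConvergence

variable {𝕜 ι E E' 𝓕 : Type*} [RCLike 𝕜] [NormedAddCommGroup E] [InnerProductSpace 𝕜 E]
  [NormedAddCommGroup E'] [InnerProductSpace 𝕜 E'] [FunLike 𝓕 E E'] [LinearIsometryClass 𝓕 𝕜 E E']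

lemma tendsto_inner_zero_of_dense {x : ι → E} {C : NNReal} (hx : ∀ i, ‖x i‖₊ ≤ C) {l : Filter ι}
    {D : Set E} (hD : Dense D) (h : ∀ w ∈ D, Tendsto (fun i => inner 𝕜 (x i) w) l (𝓝 0)) (w : E) :
    Tendsto (fun i => inner 𝕜 (x i) w) l (𝓝 0) := by
  have lipschitz (i : ι) : LipschitzWith C (inner 𝕜 (x i)) :=
    (innerSL 𝕜 (x i)).lipschitz.weaken ((innerSL_apply_norm 𝕜 (x i)).trans_le (hx i))
  have closed : IsClosed {w | Tendsto (fun i => inner 𝕜 (x i) w) l (𝓝 0)} :=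
    (LipschitzWith.uniformEquicontinuous _ _ lipschitz).equicontinuous.isClosed_setOfPred_tendsto
      continuous_const
  exact closed.closure_subset_iff.2 h (hD w)

/-- The vectors which the isometries `u i` send weakly to `0` along `l`. For suitable
unitary operators `u i = ρ (θ i)`, with all `θ i` in a group `B`, they are the orthogonal complement
of the `B`-fixed vectors. -/
def weaklyNull (u : ι → 𝓕) (l : Filter ι) : Submodule 𝕜 E where
  carrier := {v | ∀ w, Tendsto (fun i => inner 𝕜 (u i v) w) l (𝓝 0)}
  zero_mem' := by simp [tendsto_const_nhds]
  add_mem' ha hb w := by simpa [inner_add_left] using (ha w).add (hb w)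
  smul_mem' c v hv w := by simpa [inner_smul_left] using (hv w).const_mul (star c)

lemma isClosed_weaklyNull (u : ι → 𝓕) (l : Filter ι) :
    IsClosed (weaklyNull (𝕜 := 𝕜) u l : Set E) := by
  have lipschitz (w : E') (i : ι) : LipschitzWith ‖w‖₊ (fun v => inner 𝕜 (u i v) w) := by
    refine LipschitzWith.of_dist_le_mul fun v v' => ?_
    rw [dist_eq_norm, dist_eq_norm, ← inner_sub_left, ← map_sub, mul_comm,
      ← SemilinearIsometryClass.norm_map (u i) (v - v')]
    exact norm_inner_le_norm _ _
  have : (weaklyNull (𝕜 := 𝕜) u l : Set E) =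
      ⋂ w, {v | Tendsto (fun i => inner 𝕜 (u i v) w) l (𝓝 0)} := by
    ext
    simp [weaklyNull]
  rw [this]
  exact isClosed_iInter fun w =>
    (LipschitzWith.uniformEquicontinuous _ _ (lipschitz w)).equicontinuous
      |>.isClosed_setOfPred_tendsto continuous_const

end WeakConvergence

section Rep

variable {G 𝕜 H : Type*} [Group G] [RCLike 𝕜] [NormedAddCommGroup H] [InnerProductSpace 𝕜 H]
  (ρ : G →* (H ≃ₗᵢ[𝕜] H))

lemma rep_mul_apply (g h : G) (v : H) : ρ (g * h) v = ρ g (ρ h v) := by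
  rw [map_mul, LinearIsometryEquiv.coe_mul, Function.comp_apply]

lemma inner_rep_left (g : G) (v w : H) : inner 𝕜 (ρ g v) w = inner 𝕜 v (ρ g⁻¹ w) := by
  rw [← LinearIsometryEquiv.inner_map_map (ρ g) v, ← rep_mul_apply, mul_inv_cancel, map_one,
    LinearIsometryEquiv.coe_one, id]

variable {ι : Type*} {ρ} {l : Filter ι} {B : Subgroup G} {θ : ι → G} {D : Set H}

lemma rep_apply_sub_mem_weaklyNull (hD : Dense D) {b : G}
    (hb : ∀ w ∈ D, ∀ᶠ i in l, ρ (θ i * b * (θ i)⁻¹) w = w) (v : H) :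
    ρ b v - v ∈ weaklyNull (𝕜 := 𝕜) (fun i => ρ (θ i)) l := by
  refine tendsto_inner_zero_of_dense (C := ‖ρ b v - v‖₊)
    (fun i => (LinearIsometryEquiv.nnnorm_map _ _).le) hD fun w hw => ?_
  refine tendsto_const_nhds.congr' ?_
  filter_upwards [hb w hw] with i hi
  have inner_eq : inner 𝕜 (ρ (θ i) (ρ b v)) w = inner 𝕜 (ρ (θ i) v) w :=
    calc inner 𝕜 (ρ (θ i) (ρ b v)) w
        = inner 𝕜 (ρ (θ i * b * (θ i)⁻¹) (ρ (θ i) v)) (ρ (θ i * b * (θ i)⁻¹) w) := by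
          rw [hi, ← rep_mul_apply, ← rep_mul_apply, inv_mul_cancel_right]
      _ = inner 𝕜 (ρ (θ i) v) w := LinearIsometryEquiv.inner_map_map _ _ _
  rw [map_sub, inner_sub_left, inner_eq, sub_self]

variable [CompleteSpace H] {F : Submodule 𝕜 H}

lemma orthogonal_le_weaklyNull (hF : ∀ v, (∀ b ∈ B, ρ b v = v) → v ∈ F) (hD : Dense D)
    (hB : ∀ b ∈ B, ∀ w ∈ D, ∀ᶠ i in l, ρ (θ i * b * (θ i)⁻¹) w = w) :
    Fᗮ ≤ weaklyNull (𝕜 := 𝕜) (fun i => ρ (θ i)) l := by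
  set S : Submodule 𝕜 H := weaklyNull (fun i => ρ (θ i)) l
  have : CompleteSpace S := (isClosed_weaklyNull _ l).completeSpace_coe
  have orthogonal_le : Sᗮ ≤ F := fun y hy => hF y fun b hb => ext_inner_left 𝕜 fun v => by
    have := Submodule.inner_right_of_mem_orthogonal
      (rep_apply_sub_mem_weaklyNull hD (hB b⁻¹ (inv_mem hb)) v) hy
    rwa [inner_sub_left, sub_eq_zero, inner_rep_left, inv_inv] at this
  simpa only [Submodule.orthogonal_orthogonal] using Submodule.orthogonal_le orthogonal_le

theorem tendsto_inner_rep_starProjection [F.HasOrthogonalProjection]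
    (hF : ∀ v, v ∈ F ↔ ∀ b ∈ B, ρ b v = v) (hθ : ∀ i, θ i ∈ B) (hD : Dense D)
    (hB : ∀ b ∈ B, ∀ w ∈ D, ∀ᶠ i in l, ρ (θ i * b * (θ i)⁻¹) w = w) (v w : H) :
    Tendsto (fun i => inner 𝕜 (ρ (θ i) v) w) l (𝓝 (inner 𝕜 (F.starProjection v) w)) := by
  have tendsto_zero : Tendsto (fun i => inner 𝕜 (ρ (θ i) (v - F.starProjection v)) w) l (𝓝 0) :=
    orthogonal_le_weaklyNull (fun v => (hF v).2) hD hB (F.sub_starProjection_mem_orthogonal v) w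
  refine (zero_add (inner 𝕜 (F.starProjection v) w) ▸ tendsto_zero.add_const _).congr fun i => ?_
  rw [map_sub, (hF _).1 (F.starProjection_apply_mem v) _ (hθ i), inner_sub_left, sub_add_cancel]

end Rep

section Equivariance

variable {G 𝕜 X H H' : Type*} [RCLike 𝕜] [NormedAddCommGroup H] [InnerProductSpace 𝕜 H]
  [NormedAddCommGroup H'] [InnerProductSpace 𝕜 H'] {a : X → H}

lemma linearIsometryEquiv_ext_of_dense_span
    (ha : Dense (Submodule.span 𝕜 (Set.range a) : Set H)) {U W : H ≃ₗᵢ[𝕜] H'}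
    (h : ∀ x, U (a x) = W (a x)) : U = W := by
  have eq_clm : (U.toContinuousLinearEquiv : H →L[𝕜] H') = W.toContinuousLinearEquiv :=
    ContinuousLinearMap.ext_on ha (Set.forall_mem_range.2 h)
  exact LinearIsometryEquiv.ext fun v => DFunLike.congr_fun eq_clm v

variable [CompleteSpace H] [Group G]

theorem exists_intertwiner_of_inner_eq [CompleteSpace H'] {ρ : G →* (H ≃ₗᵢ[𝕜] H)}
    {ρ' : G →* (H' ≃ₗᵢ[𝕜] H')} {b : X → H'}
    (ha : Dense (Submodule.span 𝕜 (Set.range a) : Set H))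
    (hb : Dense (Submodule.span 𝕜 (Set.range b) : Set H'))
    (hab : ∀ g x y, inner 𝕜 (ρ g (a x)) (a y) = inner 𝕜 (ρ' g (b x)) (b y)) :
    ∃ W : H ≃ₗᵢ[𝕜] H', ∀ g v, W (ρ g v) = ρ' g (W v) := by
  obtain ⟨W, hW⟩ := exists_linearIsometryEquiv_of_gram_eq ha hb <| by
    ext x y
    simpa using hab 1 x y
  have intertwines (g : G) : (ρ g).trans W = W.trans (ρ' g) :=
    linearIsometryEquiv_ext_of_dense_span ha fun x => eq_of_inner_eq_of_dense_span hb fun y =>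
      calc inner 𝕜 (W (ρ g (a x))) (b y)
          = inner 𝕜 (ρ g (a x)) (a y) := by rw [← hW y, LinearIsometryEquiv.inner_map_map]
        _ = inner 𝕜 (ρ' g (W (a x))) (b y) := by rw [hab, hW]
  exact ⟨W, fun g v => DFunLike.congr_fun (intertwines g) v⟩

theorem exists_rep_of_inner_smul_smul [MulAction G X]
    (ha : Dense (Submodule.span 𝕜 (Set.range a) : Set H))
    (hG : ∀ (g : G) x y, inner 𝕜 (a (g • x)) (a (g • y)) = inner 𝕜 (a x) (a y)) :
    ∃ ρ : G →* (H ≃ₗᵢ[𝕜] H), ∀ g x, ρ g (a x) = a (g • x) := by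
  have exists_op (g : G) : ∃ U : H ≃ₗᵢ[𝕜] H, ∀ x, U (a x) = a (g • x) := by
    have range_eq : Set.range (fun x => a (g • x)) = Set.range a :=
      (MulAction.surjective g).range_comp a
    exact exists_linearIsometryEquiv_of_gram_eq ha (range_eq ▸ ha) <| by
      ext x y
      exact (hG g x y).symm
  choose ρ hρ using exists_op
  refine ⟨MonoidHom.mk' ρ fun g h => linearIsometryEquiv_ext_of_dense_span ha fun x => ?_, hρ⟩
  rw [LinearIsometryEquiv.coe_mul, Function.comp_apply, hρ, hρ, hρ, mul_smul]

end Equivariance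

variable {p q : ℕ} {κ : PairKind} {Z : Matrix (Fin q) (Fin p) ℕ} {Λ : Fin q → ℕ}

lemma Train.exists_eq_coset {α β : Train κ Z Λ} (𝔤 : α ⟶ β) : ∃ g, 𝔤 = Train.coset α β g := by
  obtain ⟨g, hg⟩ := Quotient.exists_rep 𝔤
  exact ⟨g, hg.symm⟩

lemma Train.square_coset (α β : Train κ Z Λ) (g : GGroup Z Λ) :
    Train.square (Train.coset α β g) = Train.coset β α g⁻¹ := rfl

lemma Train.eventually_coset_eq_comp (α β γ : Train κ Z Λ) (g h : GGroup Z Λ) :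
    ∀ᶠ N in atTop, Train.coset α γ (g * Theta Z Λ β.idx N * h) =
      Train.coset α β h ≫ Train.coset β γ g :=
  cosetMul_spec g h

section TrainOp

variable {H : Type u} [NormedAddCommGroup H] [InnerProductSpace ℂ H]
  (ρ : GGroup Z Λ →* (H ≃ₗᵢ[ℂ] H))

lemma fixedSubspace_mono {α β : Train κ Z Λ} (h : ∀ i, α.idx i ≤ β.idx i) :
    fixedSubspace ρ α ≤ fixedSubspace ρ β :=
  fun _ hv k hk => hv k (KSub_anti h hk)

lemma directed_fixedSubspace :
    Directed (· ≤ ·) (fixedSubspace ρ : Train κ Z Λ → Submodule ℂ H) := fun α β =>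
  ⟨⟨α.idx ⊔ β.idx⟩, fixedSubspace_mono ρ fun _ => le_max_left _ _,
    fixedSubspace_mono ρ fun _ => le_max_right _ _⟩

variable {ρ} in
lemma eventually_rep_Theta_conj_apply_eq {β γ : Train κ Z Λ} {b : GGroup Z Λ}
    (hb : b ∈ KSub κ Z Λ β.idx) {w : H} (hw : w ∈ fixedSubspace ρ γ) :
    ∀ᶠ N in atTop, ρ (Theta Z Λ β.idx N * b * (Theta Z Λ β.idx N)⁻¹) w = w := by
  obtain ⟨M, hM⟩ := exists_conj β.idx hb
  filter_upwards [eventually_ge_atTop M, eventually_ge_atTop (Finset.univ.sup γ.idx)]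
    with N hMN hγN
  rw [Theta_inv]
  refine hw _ (KSub_anti (fun i => ?_) (hM N hMN))
  calc γ.idx i ≤ Finset.univ.sup γ.idx := Finset.le_sup (Finset.mem_univ i)
    _ ≤ β.idx i + N := hγN.trans (Nat.le_add_left _ _)

variable [CompleteSpace H]

theorem tendsto_inner_rep_Theta
    (hρ : Dense (⋃ α : Train κ Z Λ, (fixedSubspace ρ α : Set H))) (β : Train κ Z Λ) (v w : H) :
    Tendsto (fun N => inner ℂ (ρ (Theta Z Λ β.idx N) v) w) atTop
      (𝓝 (inner ℂ ((fixedSubspace ρ β).starProjection v) w)) :=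
  tendsto_inner_rep_starProjection (fun _ => Iff.rfl) (fun N => Theta_mem β.idx N) hρ
    (fun _ hb _ hw => (Set.mem_iUnion.1 hw).elim fun _ => eventually_rep_Theta_conj_apply_eq hb)
    v w

lemma inner_trainOp {α β : Train κ Z Λ} (g : GGroup Z Λ)
    (v : fixedSubspace ρ α) (w : fixedSubspace ρ β) :
    inner ℂ (trainOp ρ α β g v) w = inner ℂ (ρ g (v : H)) (w : H) :=
  Submodule.inner_orthogonalProjectionOnto_eq_of_mem_right w (ρ g (v : H))

lemma trainOp_one (α : Train κ Z Λ) :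
    trainOp ρ α α 1 = ContinuousLinearMap.id ℂ (fixedSubspace ρ α) := by
  ext1 v
  refine ext_inner_right ℂ fun w => ?_
  rw [inner_trainOp, map_one]
  rfl

lemma trainOp_inv (α β : Train κ Z Λ) (g : GGroup Z Λ) :
    trainOp ρ β α g⁻¹ = ContinuousLinearMap.adjoint (trainOp ρ α β g) := by
  refine (ContinuousLinearMap.eq_adjoint_iff _ _).2 fun v w => ?_
  rw [inner_trainOp, inner_rep_left, inv_inv, ← inner_conj_symm, ← inner_trainOp ρ g w v,
    inner_conj_symm]

lemma norm_trainOp_le (α β : Train κ Z Λ) (g : GGroup Z Λ) : ‖trainOp ρ α β g‖ ≤ 1 := by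
  refine ContinuousLinearMap.opNorm_le_bound _ zero_le_one fun v => ?_
  calc ‖trainOp ρ α β g v‖ ≤ ‖ρ g (v : H)‖ :=
        (fixedSubspace ρ β).norm_orthogonalProjectionOnto_apply_le _
    _ = 1 * ‖v‖ := by rw [LinearIsometryEquiv.norm_map, one_mul, Submodule.coe_norm]

lemma eq_trainOp_comp_of_eventually_eq
    (hρ : Dense (⋃ α : Train κ Z Λ, (fixedSubspace ρ α : Set H)))
    {α β γ : Train κ Z Λ} {g h : GGroup Z Λ} {A : fixedSubspace ρ α →L[ℂ] fixedSubspace ρ γ}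
    (hA : ∀ᶠ N in atTop, trainOp ρ α γ (g * Theta Z Λ β.idx N * h) = A) :
    A = trainOp ρ β γ g ∘L trainOp ρ α β h := by
  ext1 v
  refine ext_inner_right ℂ fun w => ?_
  have tendsto_A : Tendsto (fun N => inner ℂ (ρ (Theta Z Λ β.idx N) (ρ h v)) (ρ g⁻¹ w))
      atTop (𝓝 (inner ℂ (A v) w)) := by
    refine tendsto_const_nhds.congr' ?_
    filter_upwards [hA] with N hN
    rw [← hN, inner_trainOp, ← inner_rep_left, ← rep_mul_apply, ← rep_mul_apply, mul_assoc]
  calc inner ℂ (A v) w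
      = inner ℂ ((fixedSubspace ρ β).starProjection (ρ h v)) (ρ g⁻¹ w) :=
        tendsto_nhds_unique tendsto_A (tendsto_inner_rep_Theta ρ hρ β _ _)
    _ = inner ℂ (ρ g (trainOp ρ α β h v)) w := (inner_rep_left ρ _ _ _).symm
    _ = inner ℂ (trainOp ρ β γ g (trainOp ρ α β h v)) w := (inner_trainOp ρ _ _ _).symm

end TrainOp

namespace AdmissibleRep

theorem isContractiveStarRep_train (π : AdmissibleRep.{u} κ Z Λ) :
    π.train.IsContractiveStarRep where
  map_id α := trainOp_one π.ρ α
  map_comp {α β γ} 𝔥 𝔤 := by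
    obtain ⟨h, rfl⟩ := Train.exists_eq_coset 𝔥
    obtain ⟨g, rfl⟩ := Train.exists_eq_coset 𝔤
    exact eq_trainOp_comp_of_eventually_eq π.ρ π.admissible <|
      (Train.eventually_coset_eq_comp α β γ g h).mono fun N hN => congrArg π.train.map hN
  map_square {α β} 𝔤 := by
    obtain ⟨g, rfl⟩ := Train.exists_eq_coset 𝔤
    exact trainOp_inv π.ρ α β g
  norm_le_one {α β} 𝔤 := by
    obtain ⟨g, rfl⟩ := Train.exists_eq_coset 𝔤
    exact norm_trainOp_le π.ρ α β g

end AdmissibleRep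

lemma OperatorFamily.exists_equiv_train {T : OperatorFamily.{u} κ Z Λ} {π : AdmissibleRep.{u} κ Z Λ}
    (J : ∀ α, T.V α →ₗᵢ[ℂ] π.H)
    (range_J : ∀ α, LinearMap.range (J α).toLinearMap = fixedSubspace π.ρ α)
    (inner_J : ∀ α β g v w,
      inner ℂ (π.ρ g (J α v)) (J β w) = inner ℂ (T.map (Train.coset α β g) v) w) :
    ∃ U : ∀ α, T.V α ≃ₗᵢ[ℂ] π.train.V α, ∀ (α β : Train κ Z Λ) (𝔤 : α ⟶ β) (v : T.V α),
      U β (T.map 𝔤 v) = π.train.map 𝔤 (U α v) := by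
  let U (α : Train κ Z Λ) : T.V α ≃ₗᵢ[ℂ] fixedSubspace π.ρ α :=
    (J α).equivRange.trans (LinearIsometryEquiv.ofEq _ _ (range_J α))
  refine ⟨U, fun α β 𝔤 v => ?_⟩
  obtain ⟨g, rfl⟩ := Train.exists_eq_coset 𝔤
  refine ext_inner_right ℂ fun (w : fixedSubspace π.ρ β) => ?_
  obtain ⟨w, rfl⟩ := (U β).surjective w
  calc inner ℂ (U β (T.map (Train.coset α β g) v)) (U β w)
      = inner ℂ (T.map (Train.coset α β g) v) w := LinearIsometryEquiv.inner_map_map _ _ _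
    _ = inner ℂ (π.ρ g (U α v)) (U β w : π.H) := (inner_J α β g v w).symm
    _ = inner ℂ (trainOp π.ρ α β g (U α v)) (U β w) := (inner_trainOp π.ρ g _ _).symm

namespace AdmissibleRep

/-- The contractive `*`-representation `ρ̄` of the train attached to `ρ`. -/
noncomputable def starRep (π : AdmissibleRep.{u} κ Z Λ) : StarRep.{u} κ Z Λ :=
  ⟨π.train, π.isContractiveStarRep_train⟩

variable {π π' : AdmissibleRep.{u} κ Z Λ}

theorem starRep_equiv_of_equiv (h : π ≈ π') : π.starRep ≈ π'.starRep := by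
  obtain ⟨W, hW⟩ := h
  refine OperatorFamily.exists_equiv_train
    (fun α => W.toLinearIsometry.comp (fixedSubspace π.ρ α).subtypeₗᵢ)
    (fun α => le_antisymm ?_ fun v hv => ?_)
    fun α β g (v : fixedSubspace π.ρ α) (w : fixedSubspace π.ρ β) => ?_
  · rintro _ ⟨⟨v, hv⟩, rfl⟩ k hk
    exact (hW k v).symm.trans (congrArg W (hv k hk))
  · refine ⟨⟨W.symm v, fun k hk => W.injective ?_⟩, W.apply_symm_apply v⟩
    rw [hW, W.apply_symm_apply, hv k hk]
  · calc inner ℂ (π'.ρ g (W v)) (W w)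
        = inner ℂ (π.ρ g (v : π.H)) (w : π.H) := by rw [← hW, W.inner_map_map]
      _ = inner ℂ (trainOp π.ρ α β g v) w := (inner_trainOp π.ρ g v w).symm

theorem equiv_of_starRep_equiv (h : π.starRep ≈ π'.starRep) : π ≈ π' := by
  obtain ⟨U, hU⟩ := h
  change ∀ α, fixedSubspace π.ρ α ≃ₗᵢ[ℂ] fixedSubspace π'.ρ α at U
  let a : (Σ α : Train κ Z Λ, fixedSubspace π.ρ α) → π.H := fun x => x.2
  let b : (Σ α : Train κ Z Λ, fixedSubspace π.ρ α) → π'.H := fun x => U x.1 x.2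
  have range_a : Set.range a = ⋃ α : Train κ Z Λ, (fixedSubspace π.ρ α : Set π.H) := by
    rw [Set.range_sigma_eq_iUnion_range]
    exact Set.iUnion_congr fun _ => Subtype.range_coe
  have range_b : Set.range b = ⋃ α : Train κ Z Λ, (fixedSubspace π'.ρ α : Set π'.H) := by
    have range_U (α : Train κ Z Λ) :
        Set.range (fun v => (U α v : π'.H)) = fixedSubspace π'.ρ α :=
      ((U α).surjective.range_comp Subtype.val).trans Subtype.range_coe
    rw [Set.range_sigma_eq_iUnion_range]
    exact Set.iUnion_congr range_U
  refine exists_intertwiner_of_inner_eq (a := a) (b := b)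
    ((range_a ▸ π.admissible).mono Submodule.subset_span)
    ((range_b ▸ π'.admissible).mono Submodule.subset_span) ?_
  rintro g ⟨α, v⟩ ⟨β, w⟩
  calc inner ℂ (π.ρ g (v : π.H)) (w : π.H)
      = inner ℂ (U β (trainOp π.ρ α β g v)) (U β w) := by
        rw [LinearIsometryEquiv.inner_map_map, inner_trainOp]
    _ = inner ℂ (trainOp π'.ρ α β g (U α v)) (U β w) :=
        congrArg (inner ℂ · (U β w)) (hU α β (Train.coset α β g) v)
    _ = inner ℂ (π'.ρ g (U α v : π'.H)) (U β w : π'.H) := inner_trainOp π'.ρ g _ _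

end AdmissibleRep

section Surjectivity

/-- `γ` is large for `g` and `α`: it dominates `α`, and `K^γ` commutes with `g`. Then `ρ(g)` maps
`H^α` into `H^γ`. -/
def IsLarge (γ α : Train κ Z Λ) (g : GGroup Z Λ) : Prop :=
  (∀ i, α.idx i ≤ γ.idx i) ∧ ∀ k ∈ KSub κ Z Λ γ.idx, k * g = g * k

lemma eventually_isLarge (α : Train κ Z Λ) (g : GGroup Z Λ) :
    ∀ᶠ N in atTop, IsLarge ⟨fun _ => N⟩ α g := by
  obtain ⟨M, hM⟩ := exists_commute κ g
  filter_upwards [eventually_ge_atTop M, eventually_ge_atTop (Finset.univ.sup α.idx)]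
    with N hMN hαN
  exact ⟨fun i => (Finset.le_sup (Finset.mem_univ i)).trans hαN,
    fun k hk => hM k (KSub_anti (fun _ => hMN) hk)⟩

lemma IsLarge.coset_comp {α β γ : Train κ Z Λ} {g : GGroup Z Λ} (hγ : IsLarge γ α g)
    (h : GGroup Z Λ) : Train.coset α γ g ≫ Train.coset γ β h = Train.coset α β (h * g) :=
  cosetMul_eq 0 fun N _ => (mk_eq_iff.2 ⟨1, one_mem _, Theta Z Λ γ.idx N,
    KSub_anti hγ.1 (Theta_mem _ N), by
      rw [one_mul, mul_assoc h, hγ.2 _ (Theta_mem _ N), mul_assoc]⟩).symm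

lemma Train.coset_mul_right {α β : Train κ Z Λ} (g : GGroup Z Λ) {k : GGroup Z Λ}
    (hk : k ∈ KSub κ Z Λ α.idx) : Train.coset α β (g * k) = Train.coset α β g :=
  (mk_eq_iff.2 ⟨1, one_mem _, k, hk, by rw [one_mul]⟩).symm

/-- The formal vectors `ρ(g) v` with `g ∈ G` and `v ∈ V_α`, out of which the Hilbert space of the
representation of `G` attached to `T` is built. -/
structure Translate (T : OperatorFamily.{u} κ Z Λ) where
  g : GGroup Z Λ
  α : Train κ Z Λ
  v : T.V α

variable {T : OperatorFamily.{u} κ Z Λ}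

instance : MulAction (GGroup Z Λ) (Translate T) where
  smul g x := ⟨g * x.g, x.α, x.v⟩
  one_smul x := congrArg (Translate.mk · x.α x.v) (one_mul x.g)
  mul_smul g h x := congrArg (Translate.mk · x.α x.v) (mul_assoc g h x.g)

lemma Translate.smul_mk (g h : GGroup Z Λ) (α : Train κ Z Λ) (v : T.V α) :
    g • (⟨h, α, v⟩ : Translate T) = ⟨g * h, α, v⟩ := rfl

variable (T) in
/-- The matrix of the inner products which `T` prescribes to the vectors `ρ(g) v`. -/
noncomputable def translateGram : Matrix (Translate T) (Translate T) ℂ :=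
  .of fun x y => inner ℂ (T.map (Train.coset x.α y.α (y.g⁻¹ * x.g)) x.v) y.v

lemma translateGram_apply (x y : Translate T) :
    translateGram T x y = inner ℂ (T.map (Train.coset x.α y.α (y.g⁻¹ * x.g)) x.v) y.v := rfl

lemma translateGram_smul_smul (g : GGroup Z Λ) (x y : Translate T) :
    translateGram T (g • x) (g • y) = translateGram T x y := by
  have inv_mul_eq : (g * y.g)⁻¹ * (g * x.g) = y.g⁻¹ * x.g := by group
  rw [translateGram_apply, translateGram_apply, ← inv_mul_eq]
  rfl

lemma translateGram_eq_inner (hT : T.IsContractiveStarRep) {γ : Train κ Z Λ} {x y : Translate T}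
    (hx : IsLarge γ x.α x.g) : translateGram T x y =
      inner ℂ (T.map (Train.coset x.α γ x.g) x.v) (T.map (Train.coset y.α γ y.g) y.v) := by
  rw [translateGram_apply, ← hx.coset_comp, hT.map_comp, ← Train.square_coset, hT.map_square,
    ContinuousLinearMap.comp_apply, ContinuousLinearMap.adjoint_inner_left]

open scoped ComplexOrder in
theorem posSemidef_translateGram (hT : T.IsContractiveStarRep) :
    (translateGram T).PosSemidef := by
  refine posSemidef_of_forall_finset fun s => ?_
  obtain ⟨N, hN⟩ := (s.eventually_all.2 fun x _ => eventually_isLarge x.α x.g).exists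
  have gram_eq : (translateGram T).submatrix ((↑) : s → Translate T) (↑) =
      Matrix.gram ℂ fun x : s => T.map (Train.coset x.1.α ⟨fun _ => N⟩ x.1.g) x.1.v := by
    ext x y
    exact translateGram_eq_inner hT (hN x x.2)
  exact gram_eq ▸ Matrix.posSemidef_gram ℂ _

/-- A unitary representation of `G` in `H` generated by vectors `vec x` which have the inner
products prescribed by `T` and realize the formal vectors `ρ(g) v`. -/
structure Realization (T : OperatorFamily.{u} κ Z Λ) (H : Type*) [NormedAddCommGroup H]
    [InnerProductSpace ℂ H] where
  vec : Translate T → H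
  gram_vec : Matrix.gram ℂ vec = translateGram T
  dense_span_vec : Dense (Submodule.span ℂ (Set.range vec) : Set H)
  ρ : GGroup Z Λ →* (H ≃ₗᵢ[ℂ] H)
  rho_vec : ∀ g x, ρ g (vec x) = vec (g • x)

theorem exists_realization (hT : T.IsContractiveStarRep) :
    ∃ (H : Type u) (_ : NormedAddCommGroup H) (_ : InnerProductSpace ℂ H) (_ : CompleteSpace H),
      Nonempty (Realization T H) := by
  obtain ⟨H, _, _, _, a, gram_a, dense_a⟩ := exists_gram_eq_of_posSemidef <|
    posSemidef_translateGram hT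
  have inner_a (x y : Translate T) : inner ℂ (a x) (a y) = translateGram T x y :=
    congrFun₂ gram_a x y
  obtain ⟨ρ, hρ⟩ := exists_rep_of_inner_smul_smul (G := GGroup Z Λ) dense_a fun g x y => by
    rw [inner_a, inner_a, translateGram_smul_smul]
  exact ⟨H, _, _, ‹_›, ⟨⟨a, gram_a, dense_a, ρ, hρ⟩⟩⟩

namespace Realization

variable {H : Type u} [NormedAddCommGroup H] [InnerProductSpace ℂ H] (R : Realization T H)
  (hT : T.IsContractiveStarRep)

lemma inner_vec {α β : Train κ Z Λ} (g h : GGroup Z Λ) (v : T.V α) (w : T.V β) :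
    inner ℂ (R.vec ⟨g, α, v⟩) (R.vec ⟨h, β, w⟩) =
      inner ℂ (T.map (Train.coset α β (h⁻¹ * g)) v) w :=
  congrFun₂ R.gram_vec ⟨g, α, v⟩ ⟨h, β, w⟩

/-- The isometric embedding of `V_α`, whose image will be the space of `K^α`-fixed vectors. -/
noncomputable def embed (α : Train κ Z Λ) : T.V α →ₗᵢ[ℂ] H where
  toFun v := R.vec ⟨1, α, v⟩
  map_add' v w := eq_of_inner_eq_of_dense_span R.dense_span_vec fun ⟨_, _, _⟩ => by
    simp only [inner_add_left, inner_vec, map_add]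
  map_smul' c v := eq_of_inner_eq_of_dense_span R.dense_span_vec fun ⟨_, _, _⟩ => by
    simp only [RingHom.id_apply, inner_smul_left, inner_vec, map_smul]
  norm_map' v := by
    have map_coset_one : T.map (Train.coset α α 1) = ContinuousLinearMap.id ℂ (T.V α) :=
      hT.map_id α
    change ‖R.vec ⟨1, α, v⟩‖ = ‖v‖
    simp only [@norm_eq_sqrt_re_inner ℂ, inner_vec, inv_one, one_mul, map_coset_one,
      ContinuousLinearMap.id_apply]

lemma embed_apply (α : Train κ Z Λ) (v : T.V α) : R.embed hT α v = R.vec ⟨1, α, v⟩ := rfl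

lemma inner_rho_embed {α β : Train κ Z Λ} (g : GGroup Z Λ) (v : T.V α) (w : T.V β) :
    inner ℂ (R.ρ g (R.embed hT α v)) (R.embed hT β w) =
      inner ℂ (T.map (Train.coset α β g) v) w := by
  rw [embed_apply, embed_apply, rho_vec, Translate.smul_mk, inner_vec, inv_one, one_mul, mul_one]

lemma vec_eq_embed {γ : Train κ Z Λ} {x : Translate T} (hx : IsLarge γ x.α x.g) :
    R.vec x = R.embed hT γ (T.map (Train.coset x.α γ x.g) x.v) := by
  obtain ⟨g, α, v⟩ := x
  refine eq_of_inner_eq_of_dense_span R.dense_span_vec fun ⟨h, β, w⟩ => ?_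
  rw [embed_apply, inner_vec, inner_vec, mul_one, ← ContinuousLinearMap.comp_apply,
    ← hT.map_comp, hx.coset_comp]

lemma exists_vec_eq_embed (x : Translate T) : ∃ γ w, R.vec x = R.embed hT γ w :=
  (eventually_isLarge x.α x.g).exists.elim fun _ hN => ⟨_, _, R.vec_eq_embed hT hN⟩

lemma embed_mem_fixedSubspace {α : Train κ Z Λ} (v : T.V α) :
    R.embed hT α v ∈ fixedSubspace R.ρ α := by
  refine fun k hk => eq_of_inner_eq_of_dense_span R.dense_span_vec fun ⟨h, β, w⟩ => ?_
  rw [embed_apply, rho_vec, Translate.smul_mk, inner_vec, inner_vec, mul_one, mul_one,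
    Train.coset_mul_right _ hk]

include hT in
lemma dense_iUnion_fixedSubspace :
    Dense (⋃ α : Train κ Z Λ, (fixedSubspace R.ρ α : Set H)) := by
  have : Nonempty (Train κ Z Λ) := ⟨⟨0⟩⟩
  rw [← Submodule.coe_iSup_of_directed _ (directed_fixedSubspace R.ρ)]
  refine R.dense_span_vec.mono (Submodule.span_le.2 ?_)
  rintro _ ⟨x, rfl⟩
  obtain ⟨γ, w, hw⟩ := R.exists_vec_eq_embed hT x
  exact hw ▸ Submodule.mem_iSup_of_mem γ (R.embed_mem_fixedSubspace hT w)

variable [CompleteSpace H]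

lemma starProjection_embed (α γ : Train κ Z Λ) (v : T.V γ) :
    (fixedSubspace R.ρ α).starProjection (R.embed hT γ v) =
      R.embed hT α (T.map (Train.coset γ α 1) v) := by
  refine eq_of_inner_eq_of_dense_span R.dense_span_vec fun y => ?_
  obtain ⟨δ, w, hw⟩ := R.exists_vec_eq_embed hT y
  rw [hw]
  refine tendsto_nhds_unique (tendsto_inner_rep_Theta R.ρ (R.dense_iUnion_fixedSubspace hT) α _ _)
    (tendsto_const_nhds.congr' ?_)
  filter_upwards [Train.eventually_coset_eq_comp γ α δ 1 1] with N hN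
  rw [one_mul, mul_one] at hN
  calc inner ℂ (R.embed hT α (T.map (Train.coset γ α 1) v)) (R.embed hT δ w)
      = inner ℂ (R.ρ 1 (R.embed hT α (T.map (Train.coset γ α 1) v))) (R.embed hT δ w) := by
        rw [map_one, LinearIsometryEquiv.coe_one, id]
    _ = inner ℂ (T.map (Train.coset γ δ (Theta Z Λ α.idx N)) v) w := by
        rw [inner_rho_embed, hN, hT.map_comp, ContinuousLinearMap.comp_apply]
    _ = inner ℂ (R.ρ (Theta Z Λ α.idx N) (R.embed hT γ v)) (R.embed hT δ w) :=
        (R.inner_rho_embed hT _ v w).symm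

theorem range_embed (α : Train κ Z Λ) :
    LinearMap.range (R.embed hT α).toLinearMap = fixedSubspace R.ρ α := by
  refine le_antisymm ?_ fun v hv => ?_
  · rintro _ ⟨v, rfl⟩
    exact R.embed_mem_fixedSubspace hT v
  set P := (fixedSubspace R.ρ α).starProjection
  set V := LinearMap.range (R.embed hT α).toLinearMap
  have isClosed_V : IsClosed (V : Set H) := by
    rw [LinearMap.coe_range]
    exact (R.embed hT α).isometry.isClosedEmbedding.isClosed_range
  have span_le : Submodule.span ℂ (Set.range R.vec) ≤ V.comap P.toLinearMap := by
    refine Submodule.span_le.2 ?_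
    rintro _ ⟨x, rfl⟩
    obtain ⟨γ, w, hw⟩ := R.exists_vec_eq_embed hT x
    exact ⟨_, (hw ▸ R.starProjection_embed hT α γ w).symm⟩
  have P_mem (x : H) : P x ∈ V :=
    (isClosed_V.preimage P.continuous).closure_subset_iff.2 span_le (R.dense_span_vec x)
  exact Submodule.starProjection_eq_self_iff.2 hv ▸ P_mem v

end Realization

theorem exists_starRep_equiv (T : StarRep.{u} κ Z Λ) :
    ∃ π : AdmissibleRep.{u} κ Z Λ, T ≈ π.starRep := by
  obtain ⟨H, _, _, _, ⟨R⟩⟩ := exists_realization T.2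
  exact ⟨⟨H, R.ρ, R.dense_iUnion_fixedSubspace T.2⟩, OperatorFamily.exists_equiv_train
    (R.embed T.2) (R.range_embed T.2) fun _ _ => R.inner_rho_embed T.2⟩

end Surjectivity

/-- The map `ρ ↦ ρ̄` on unitary equivalence classes. -/
noncomputable def starRepClass : Quotient (AdmissibleRep.setoid.{u} κ Z Λ) →
    Quotient (StarRep.setoid.{u} κ Z Λ) :=
  Quotient.map AdmissibleRep.starRep fun _ _ => AdmissibleRep.starRep_equiv_of_equiv

theorem bijective_starRepClass : Function.Bijective (starRepClass (κ := κ) (Z := Z) (Λ := Λ)) := by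
  constructor
  · rintro ⟨π⟩ ⟨π'⟩ h
    exact Quotient.sound (AdmissibleRep.equiv_of_starRep_equiv (Quotient.exact h))
  · rintro ⟨T⟩
    obtain ⟨π, hπ⟩ := exists_starRep_equiv T
    exact ⟨Quotient.mk _ π, (Quotient.sound hπ).symm⟩

end SymTrain

theorem mainTheorem3 {p q : ℕ} (hp : 0 < p) (hq : 0 < q)
    (Z : Matrix (Fin q) (Fin p) ℕ) (hrow : ∀ j, ∃ i, Z j i ≠ 0) (hcol : ∀ i, ∃ j, Z j i ≠ 0)
    (Λ : Fin q → ℕ) (κ : SymTrain.PairKind) :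
    ∃ h : ∀ π : SymTrain.AdmissibleRep.{u} κ Z Λ, π.train.IsContractiveStarRep,
      ∃ Φ : Quotient (SymTrain.AdmissibleRep.setoid.{u} κ Z Λ) ≃
          Quotient (SymTrain.StarRep.setoid.{u} κ Z Λ),
        ∀ π : SymTrain.AdmissibleRep.{u} κ Z Λ,
          Φ (Quotient.mk _ π) = Quotient.mk _ ⟨π.train, h π⟩ :=
  ⟨SymTrain.AdmissibleRep.isContractiveStarRep_train,
    Equiv.ofBijective SymTrain.starRepClass SymTrain.bijective_starRepClass, fun _ => rfl⟩
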